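/- Conventions. Let $x:M^n\to\mathbb R^{n+1}$ be a smooth nondegenerate hypersurface. In local coordinates $(u^i)$ put $h_{ij}=\det(\partial_1x,\dots,\partial_nx,\partial_i\partial_jx)$ and $H=|\det(h_{ij})|\neq 0$. The affine metric is $g_{ij}=H^{-1/(n+2)}h_{ij}$, determined up to a sign which is fixed by an orientation; the affine normal is $\xi=\frac1n\Delta_g x$; the affine shape operator $B$ is defined by $d\xi=-dx\circ B$; and the affine mean curvature is $L_1=\frac1n\operatorname{tr}B$. The hypersurface is a hyperbolic affine hypersphere if (for some choice of the orientation) $B=L_1\,\mathrm{id}$ with $L_1$ a negative constant; the point $o$ is its affine center if all affine lines $x(p)+\mathbb R\,\xi(p)$ pass through $o$. Two hypersurfaces $x,y:M^n\to\mathbb R^{n+1}$ are called equiaffine equivalent here if $y=T\circ x$ for an affine transformation $T$ of $\mathbb R^{n+1}$ whose linear part has determinant $1$. Theorem. Let $r,s\ge 0$ be integers with $K:=r+s\geq 2$, and let $x_\alpha:M_\alpha\to\mathbb R^{n_\alpha+1}$, $1\le\alpha\le s$, be hyperbolic affine hyperspheres of dimensions $n_\alpha>0$ with affine mean curvatures $L_1^{(\alpha)}$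 and with the origin as common affine center. Let $N_1=\dots=N_r=0$ and $N_{r+\alpha}=n_\alpha$ for $1\le\alpha\le s$, let $f_a=N_1+\dots+N_a+a$ for $1\le a\le K$, and for $t=(t_1,\dots,t_{K-1})\in\mathbb R^{K-1}$ put $$e_a=\exp\Big(-\frac{t_{a-1}}{N_a+1}+\frac{t_a}{f_a}+\frac{t_{a+1}}{f_{a+1}}+\dots+\frac{t_{K-1}}{f_{K-1}}\Big),\qquad 1\le a\le K,$$ where the term with $t_{a-1}$ is absent for $a=1$. Let $n=\sum_\alpha n_\alpha+K-1$ and $M^n=\mathbb R^{K-1}\times M_1\times\dots\times M_s$. Then for any positive numbers $c_1,\dots,c_K$ the map $x:M^n\to\mathbb R^{n+1}$, $$x(t,p_1,\dots,p_s)=\big(c_1e_1,\dots,c_re_r,\;c_{r+1}e_{r+1}x_1(p_1),\dots,c_Ke_Kx_s(p_s)\big),$$ is a hyperbolic affine hypersphere with affine mean curvature $$L_1=-\frac1{(n+1)C},\qquad C=\left(\frac1{n+1}\prod_{a=1}^r c_a^2\cdot\prod_{\alpha=1}^s\frac{c_{r+\alpha}^{2(n_\alpha+1)}}{(n_\alpha+1)^{n_\alpha+1}\,(-L_1^{(\alpha)})^{n_\alpha+2}}\right)^{\frac1{n+2}};$$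 moreover, its affine metric is positive definite if those of all $x_\alpha$ are. Furthermore, for given positive numbers $c_1,\dots,c_K$ there exist $c>0$ and $c'>0$ such that the following three hypersurfaces, all of this form, are pairwise equiaffine equivalent: $x$ itself; the hypersurface $\bar x=c\,(e_1,\dots,e_r,e_{r+1}x_1,\dots,e_Kx_s)$; and the hypersurface $\tilde x$ obtained from $(e_1,\dots,e_r,e_{r+1}x_1,\dots,e_Kx_s)$ by multiplying the last ($K$-th) block by $c'$. -/

import Mathlib

open Set
open scoped Manifold ContDiff

noncomputable section

namespace EquiAffine

section Hypersurface

variable {E : Type*} [NormedAddCommGroup E] [NormedSpace ℝ E]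
  {W : Type*} [NormedAddCommGroup W] [NormedSpace ℝ W]
  {κ ι : Type*} [Fintype κ] [DecidableEq κ] [Fintype ι]

/-- The partial derivative `∂F/∂uⁱ` with respect to the linear coordinates of the basis `b`. -/
def partialDeriv (b : Module.Basis κ ℝ E) (i : κ) (F : E → W) (u : E) : W :=
  fderiv ℝ F u (b i)

/-- The matrix `h_ij = det (∂₁X, …, ∂ₙX, ∂ᵢ∂ⱼX)` of a map `X` of an `n`-dimensional space into the
coordinate space `ℝ^ι`, where `c` (which forces `|ι| = n + 1`) enumerates the coordinates of the
target; another enumeration changes `h` at most by a global sign. -/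
def hMatrix (b : Module.Basis κ ℝ E) (c : Option κ ≃ ι) (X : E → ι → ℝ) (u : E) :
    Matrix κ κ ℝ :=
  Matrix.of fun i j => Matrix.det (Matrix.of fun (k l : Option κ) =>
    (l.elim (partialDeriv b i (partialDeriv b j X) u) fun m => partialDeriv b m X u) (c k))

/-- The matrix `H^(-1/(n+2)) h_ij`, `H = |det h|`. -/
def blaschkeMatrix (b : Module.Basis κ ℝ E) (c : Option κ ≃ ι) (X : E → ι → ℝ) (u : E) :
    Matrix κ κ ℝ :=
  (|(hMatrix b c X u).det| ^ (-1 / ((Fintype.card κ : ℝ) + 2))) • hMatrix b c X u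

/-- The Laplacian `|G|^(-1/2) ∑ ∂ᵢ (|G|^(1/2) g^{ij} ∂ⱼF)`, `G = det g`, of a vector valued
function with respect to the pseudo-Riemannian metric with coordinate matrix `g`. -/
def laplacian (b : Module.Basis κ ℝ E) (g : E → Matrix κ κ ℝ) (F : E → W) (u : E) : W :=
  (Real.sqrt |(g u).det|)⁻¹ • ∑ i, ∑ j,
    partialDeriv b i (fun w => (Real.sqrt |(g w).det| * (g w)⁻¹ i j) • partialDeriv b j F w) u

variable {H : Type*} [TopologicalSpace H] (I : ModelWithCorners ℝ E H)
  {M : Type*} [TopologicalSpace M] [ChartedSpace H M]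

/-- `x : M → ℝ^ι` is a smooth nondegenerate hypersurface with affine (Berwald-Blaschke) metric `g`.
The local coordinates are those of the charts `e` of the atlas, followed by the linear coordinates
of `b`; `g e` is the coordinate matrix of the metric in the chart `e`. The metric is given by
`H^(-1/(n+2)) h_ij` up to a sign, which is the choice of an orientation; it is locally
constant because `g e` is continuous. (Nondegeneracy makes `x` an immersion if `n > 0`.) -/
def IsAffineMetric (b : Module.Basis κ ℝ E) (x : M → ι → ℝ)
    (g : OpenPartialHomeomorph M H → E → Matrix κ κ ℝ) : Prop :=
  ContMDiff I 𝓘(ℝ, ι → ℝ) ∞ x ∧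
  ∃ c : Option κ ≃ ι, ∀ e ∈ atlas H M,
    ContinuousOn (g e) (e.extend I).target ∧
    ∀ u ∈ (e.extend I).target,
      (hMatrix b c (x ∘ (e.extend I).symm) u).det ≠ 0 ∧
      (g e u = blaschkeMatrix b c (x ∘ (e.extend I).symm) u ∨
        g e u = -blaschkeMatrix b c (x ∘ (e.extend I).symm) u)

/-- `ξ` is the affine normal `(1/n) Δ_g x`. As `ξ` is one function on `M`, this also forces the
orientation signs of `g` in overlapping charts to match. -/
def IsAffineNormal (b : Module.Basis κ ℝ E) (x : M → ι → ℝ)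
    (g : OpenPartialHomeomorph M H → E → Matrix κ κ ℝ) (ξ : M → ι → ℝ) : Prop :=
  ∀ e ∈ atlas H M, ∀ u ∈ (e.extend I).target,
    ξ ((e.extend I).symm u) =
      (Fintype.card κ : ℝ)⁻¹ • laplacian b (g e) (x ∘ (e.extend I).symm) u

/-- `B` is the affine shape operator: `dξ = -dx ∘ B`. -/
def IsAffineShapeOperator (x ξ : M → ι → ℝ)
    (B : ∀ p : M, TangentSpace I p →ₗ[ℝ] TangentSpace I p) : Prop :=
  ∀ (p : M) (v : TangentSpace I p),
    (mfderiv I 𝓘(ℝ, ι → ℝ) ξ p v : ι → ℝ) = -(mfderiv I 𝓘(ℝ, ι → ℝ) x p (B p v) : ι → ℝ)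

/-- The affine mean curvature `L₁ = (1/n) tr B`. -/
def affineMeanCurvature (B : ∀ p : M, TangentSpace I p →ₗ[ℝ] TangentSpace I p) (p : M) : ℝ :=
  LinearMap.trace ℝ (TangentSpace I p) (B p) / (Module.finrank ℝ E : ℝ)

/-- `x`, with affine metric `g` and affine normal `ξ`, is a hyperbolic affine hypersphere with
affine mean curvature `L`: all the affine principal curvatures equal the negative constant `L`,
that is, `B = L · id`. -/
def IsHyperbolicAffineHypersphere (b : Module.Basis κ ℝ E) (x : M → ι → ℝ)
    (g : OpenPartialHomeomorph M H → E → Matrix κ κ ℝ) (ξ : M → ι → ℝ) (L : ℝ) : Prop :=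
  IsAffineMetric I b x g ∧ IsAffineNormal I b x g ξ ∧ L < 0 ∧
  ∃ B : ∀ p : M, TangentSpace I p →ₗ[ℝ] TangentSpace I p,
    IsAffineShapeOperator I x ξ B ∧
    ∀ p : M, affineMeanCurvature I B p = L ∧ ∀ v : TangentSpace I p, B p v = L • v

/-- The affine metric is positive definite (`x` is locally strongly convex, suitably oriented). -/
def IsPositiveDefinite (g : OpenPartialHomeomorph M H → E → Matrix κ κ ℝ) : Prop :=
  ∀ e ∈ atlas H M, ∀ u ∈ (e.extend I).target, (g e u).PosDef

/-- All the affine lines `x(p) + ℝ ξ(p)` pass through the point `o`. -/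
def HasAffineCenter {M ι : Type*} (x ξ : M → ι → ℝ) (o : ι → ℝ) : Prop :=
  ∀ p : M, ∃ σ : ℝ, x p + σ • ξ p = o

/-- `y` is the image of `x` under an equiaffine (volume and orientation preserving affine)
transformation of the ambient space; no reparametrization of `M` is used. -/
def EquiaffineEquivalent {M ι : Type*} (x y : M → ι → ℝ) : Prop :=
  ∃ T : (ι → ℝ) ≃ᵃ[ℝ] (ι → ℝ),
    LinearMap.det (T.linear : (ι → ℝ) →ₗ[ℝ] (ι → ℝ)) = 1 ∧ ∀ p, y p = T (x p)

end Hypersurface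

section Composition

/-- `f_m = ∑_{a ≤ m} (n_a + 1)`, for factors of dimensions `n₁, …, n_K` (here `a` runs from `0`). -/
def partialSum {K : ℕ} (N : Fin K → ℕ) (m : ℕ) : ℕ :=
  ∑ a : Fin K with a.val < m, (N a + 1)

/-- `e_a = exp (-t_{a-1}/(n_a + 1) + t_a/f_a + ⋯ + t_{K-1}/f_{K-1})`, without the first term if
`a = 1`. Here `a : Fin K` and `l : Fin (K - 1)` run from `0`, so that they stand for the factor
`a + 1` and for the variable `t_{l+1}`. -/
def expFactor {K : ℕ} (N : Fin K → ℕ) (t : Fin (K - 1) → ℝ) (a : Fin K) : ℝ :=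
  Real.exp (-(∑ l : Fin (K - 1) with l.val + 1 = a.val, t l / ((N a : ℝ) + 1))
    + ∑ l : Fin (K - 1) with a.val ≤ l.val, t l / (partialSum N (l.val + 1) : ℝ))

variable (r : ℕ) {s : ℕ} (n : Fin s → ℕ)

/-- The dimensions `0, …, 0, n₁, …, n_s` of the `r + s` factors. -/
def factorDim : Fin (r + s) → ℕ := Fin.append (fun _ : Fin r => 0) n

/-- The dimension `n₁ + ⋯ + n_s + K - 1` of the composition, `K = r + s`. -/
def compDim : ℕ := ∑ α, n α + (r + s - 1)

/-- The constant `C` of the composition. -/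
def compConst (c : Fin (r + s) → ℝ) (L : Fin s → ℝ) : ℝ :=
  (1 / ((compDim r n : ℝ) + 1) * (∏ a : Fin r, c (Fin.castAdd s a) ^ 2) *
    ∏ α : Fin s, c (Fin.natAdd r α) ^ (2 * (n α + 1)) /
      (((n α : ℝ) + 1) ^ (n α + 1) * (-L α) ^ (n α + 2))) ^ (1 / ((compDim r n : ℝ) + 2))

/-- The coordinates of the ambient space `ℝ^r × ∏ ℝ^(n_α + 1)`; there are `n + 1` of them. -/
abbrev AmbientIndex : Type := Fin r ⊕ (Σ α : Fin s, Fin (n α + 1))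

variable {M : Fin s → Type*}

/-- `M^n = ℝ^(K-1) × M₁ × ⋯ × M_s`. -/
abbrev CompDomain (r : ℕ) {s : ℕ} (M : Fin s → Type*) : Type _ :=
  EuclideanSpace ℝ (Fin (r + s - 1)) × (∀ α, M α)

/-- The Calabi composition
`(c₁e₁, …, c_r e_r, c_{r+1} e_{r+1} x₁(p₁), …, c_K e_K x_s(p_s))` of `r` points and `x₁, …, x_s`. -/
def calabiComposition (c : Fin (r + s) → ℝ) (x : ∀ α, M α → Fin (n α + 1) → ℝ) :
    CompDomain r M → AmbientIndex r n → ℝ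
  | (t, _), Sum.inl a =>
      c (Fin.castAdd s a) * expFactor (factorDim r n) t (Fin.castAdd s a)
  | (t, p), Sum.inr ⟨α, k⟩ =>
      c (Fin.natAdd r α) * expFactor (factorDim r n) t (Fin.natAdd r α) * x α (p α) k

/-- The model of the product manifold `ℝ^(K-1) × M₁ × ⋯ × M_s`. -/
abbrev compModel : ModelWithCorners ℝ
    (EuclideanSpace ℝ (Fin (r + s - 1)) × (∀ α, EuclideanSpace ℝ (Fin (n α))))
    (ModelProd (EuclideanSpace ℝ (Fin (r + s - 1)))
      (ModelPi fun α => EuclideanSpace ℝ (Fin (n α)))) :=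
  (𝓘(ℝ, EuclideanSpace ℝ (Fin (r + s - 1)))).prod
    (ModelWithCorners.pi fun α => 𝓘(ℝ, EuclideanSpace ℝ (Fin (n α))))

/-- The standard basis of `ℝ^m`. -/
abbrev stdBasis (m : ℕ) : Module.Basis (Fin m) ℝ (EuclideanSpace ℝ (Fin m)) :=
  (EuclideanSpace.basisFun (Fin m) ℝ).toBasis

/-- The standard basis of `ℝ^(K-1) × ∏ ℝ^(n_α)`. -/
def compBasis : Module.Basis (Fin (r + s - 1) ⊕ (Σ α : Fin s, Fin (n α))) ℝ
    (EuclideanSpace ℝ (Fin (r + s - 1)) × (∀ α, EuclideanSpace ℝ (Fin (n α)))) :=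
  (stdBasis (r + s - 1)).prod (Pi.basis fun α => stdBasis (n α))

end Composition

end EquiAffine

end

/-!
Write `Λ = -L`. The argument describes a hypersurface by its position vector instead of its affine
normal. Let `frameDet v = det (∂₁X, …, ∂ₙX, v)` and `D = frameDet X`; then `h_ij` is
`frameDet (∂ᵢ∂ⱼX)`, so that `h = D a`, where `a` is the second fundamental form with respect to the
transverse field `X`.

For a hyperbolic affine hypersphere with centre at the origin, `ξ = Λ X` (`affineNormal_eq`), that
is, `Δ_g X = n Λ X`. Comparing the components normal to the hypersurface gives `D ≠ 0`,
`a = Λ g` and `|det g| = (Λ D)²` (`frameDet_self_of_laplacian_eq`). These facts about the factors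
are recorded in `IsCentredAt`.

For the composition, give the block with index `a` the weight `W_a = N_a + 1`, and let `lam_a(l)` be
the coefficient of `t_l` in the exponent of `e_a`. With respect to these weights the vectors `lam(l)`
and the constant vector form an orthogonal basis of `ℝ^K`, with square lengths `q_l` and
`S = ∑ W_a = n + 1` (`sum_mul_expCoeff`, `sum_mul_expCoeff_mul_expCoeff`). As
`∂X/∂t_l = ∑ lam_a(l) X_a` for the blocks `X_a` of `X`, modulo the tangent space `X_a` equals
`W_a / S` times `X`. So `a` is block diagonal: its entries are `q_l / S` in the directions `t_l`, and
its block on the factor with index `α` is `W_α / S` times that of the factor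
(`hMatrix_calabiComposition`). The frame of `X` factors into the frames of the blocks and the
matrix of the orthogonal basis, which yields `D²` (`frameDet_calabiComposition_sq`). This gives
`|det a| = Λ^(n+2) D²` for `Λ = 1 / ((n + 1) C)`, an identity that determines `C`
(`abs_det_compForm`), and `a / Λ` is the affine metric up to sign (`compMetric_eq_blaschkeMatrix`).
It is the product of a flat metric and constant multiples of the metrics of the factors, so that
`Δ X = n Λ X` follows from the same equation for the factors and from Bessel's equality
(`laplacian_calabiComposition`, `laplacian_compMetric`). Hence the affine normal is `Λ X`, and the
shape operator is `-Λ id`.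

The equivalences of the last part are given by diagonal maps, whose determinants are controlled by
`∏ c_a ^ W_a`.
-/

namespace EquiAffine

/-! ### Determinants -/

theorem det_blockDiagonal' {o : Type*} [Fintype o] [LinearOrder o] {m : o → Type*}
    [∀ k, Fintype (m k)] [∀ k, DecidableEq (m k)] (A : ∀ k, Matrix (m k) (m k) ℝ) :
    (Matrix.blockDiagonal' A).det = ∏ k, (A k).det := by
  rw [(Matrix.blockTriangular_blockDiagonal' A).det_fintype]
  refine Finset.prod_congr rfl fun k _ => ?_
  rw [← Matrix.det_submatrix_equiv_self (Equiv.sigmaSubtype k).symm]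
  congr 1
  ext i j
  simp [Matrix.toSquareBlock, Matrix.toSquareBlockProp, Equiv.sigmaSubtype]

/-- Two ways of enumerating the rows and the columns of a matrix give determinants that agree up
to sign. -/
theorem abs_det_submatrix_eq {m m' ι o : Type*} [Fintype m] [DecidableEq m] [Fintype m']
    [DecidableEq m'] (A : Matrix ι o ℝ) (e₁ : m ≃ ι) (e₂ : m ≃ o) (e₁' : m' ≃ ι) (e₂' : m' ≃ o) :
    |(A.submatrix e₁ e₂).det| = |(A.submatrix e₁' e₂').det| := by
  rw [← Matrix.abs_det_submatrix_equiv_equiv (e₁.trans e₁'.symm) (e₂.trans e₂'.symm)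
    (A.submatrix e₁' e₂')]
  congr 2
  ext i j
  simp

section Differentiability

variable {E : Type*} [NormedAddCommGroup E] [NormedSpace ℝ E] {κ : Type*} [Fintype κ]
  [DecidableEq κ]

theorem differentiableAt_det {A : E → Matrix κ κ ℝ} {u : E}
    (hA : ∀ i j, DifferentiableAt ℝ (fun w => A w i j) u) :
    DifferentiableAt ℝ (fun w => (A w).det) u := by
  simp only [Matrix.det_apply']
  fun_prop

theorem differentiableAt_inv_apply {A : E → Matrix κ κ ℝ} {u : E}
    (hA : ∀ i j, DifferentiableAt ℝ (fun w => A w i j) u) (hu : (A u).det ≠ 0) (i j : κ) :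
    DifferentiableAt ℝ (fun w => (A w)⁻¹ i j) u := by
  simp only [Matrix.inv_def, Matrix.smul_apply, smul_eq_mul, Ring.inverse_eq_inv',
    Matrix.adjugate_apply]
  refine ((differentiableAt_det hA).inv hu).mul (differentiableAt_det fun k l => ?_)
  by_cases h : k = j
  · subst h; simp
  · simpa [Matrix.updateRow_ne h] using hA k l

end Differentiability

/-! ### The frame determinant of a hypersurface -/

section Frame

variable {E : Type*} [NormedAddCommGroup E] [NormedSpace ℝ E]
  {κ ι : Type*} [Fintype κ] [DecidableEq κ] [Fintype ι]

/-- The linear functional `v ↦ det (∂₁X, …, ∂ₙX, v)`, with the coordinates of the target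
enumerated by `c`. -/
noncomputable def frameDet (b : Module.Basis κ ℝ E) (c : Option κ ≃ ι) (X : E → ι → ℝ) (u : E) :
    (ι → ℝ) →ₗ[ℝ] ℝ :=
  LinearMap.proj none ∘ₗ Matrix.cramer (Matrix.of fun (k l : Option κ) =>
    (l.elim 0 fun m => partialDeriv b m X u) (c k)) ∘ₗ LinearMap.funLeft ℝ ℝ c

theorem frameDet_apply (b : Module.Basis κ ℝ E) (c : Option κ ≃ ι) (X : E → ι → ℝ) (u : E)
    (v : ι → ℝ) :
    frameDet b c X u v = Matrix.det (Matrix.of fun (k l : Option κ) =>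
      (l.elim v fun m => partialDeriv b m X u) (c k)) := by
  simp only [frameDet, LinearMap.comp_apply, LinearMap.proj_apply, Matrix.cramer_apply]
  congr 1
  ext k l
  cases l <;> simp [LinearMap.funLeft]

theorem hMatrix_apply (b : Module.Basis κ ℝ E) (c : Option κ ≃ ι) (X : E → ι → ℝ) (u : E)
    (i j : κ) :
    hMatrix b c X u i j = frameDet b c X u (partialDeriv b i (partialDeriv b j X) u) := by
  rw [frameDet_apply]; rfl

theorem frameDet_partialDeriv (b : Module.Basis κ ℝ E) (c : Option κ ≃ ι) (X : E → ι → ℝ) (u : E)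
    (m : κ) : frameDet b c X u (partialDeriv b m X u) = 0 := by
  rw [frameDet_apply]
  exact Matrix.det_zero_of_column_eq (i := none) (j := some m) (by simp) fun k => rfl

/-- By Cramer's rule, a functional that vanishes on the tangent space of `X` is proportional to
the frame determinant. -/
theorem apply_mul_frameDet (b : Module.Basis κ ℝ E) (c : Option κ ≃ ι) (X : E → ι → ℝ) (u : E)
    (ψ : (ι → ℝ) →ₗ[ℝ] ℝ) (hψ : ∀ m, ψ (partialDeriv b m X u) = 0) (v y : ι → ℝ) :
    ψ v * frameDet b c X u y = ψ y * frameDet b c X u v := by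
  set A : Matrix (Option κ) (Option κ) ℝ := Matrix.of fun (k l : Option κ) =>
    (l.elim y fun m => partialDeriv b m X u) (c k) with hA
  have h1 := Matrix.mulVec_cramer A (v ∘ c)
  have h2 : Matrix.cramer A (v ∘ c) none = frameDet b c X u v := by
    rw [Matrix.cramer_apply, frameDet_apply]
    congr 1
    ext k l
    cases l <;> simp [hA]
  have h3 : A.det = frameDet b c X u y := by rw [frameDet_apply]
  have h4 : ∑ l : Option κ, Matrix.cramer A (v ∘ c) l •
      (l.elim y fun m => partialDeriv b m X u : ι → ℝ) = A.det • v := by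
    ext i
    obtain ⟨k, rfl⟩ := c.surjective i
    have := congrFun h1 k
    simp only [Matrix.mulVec, dotProduct, Pi.smul_apply, Function.comp_apply] at this
    rw [Pi.smul_apply, ← this, Finset.sum_apply]
    refine Finset.sum_congr rfl fun l _ => ?_
    simp [hA, mul_comm]
  have h5 := congrArg ψ h4
  rw [map_sum, Fintype.sum_option] at h5
  simp only [map_smul, Option.elim_some, Option.elim_none, hψ, smul_eq_mul, mul_zero,
    Finset.sum_const_zero, add_zero, h2, h3] at h5
  linarith

end Frame

/-! ### Partial derivatives -/

section PartialDeriv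

variable {E : Type*} [NormedAddCommGroup E] [NormedSpace ℝ E]
  {W : Type*} [NormedAddCommGroup W] [NormedSpace ℝ W]
  {κ ι : Type*}

theorem partialDeriv_congr (b : Module.Basis κ ℝ E) (i : κ) {F F' : E → W} {u : E}
    (h : F =ᶠ[nhds u] F') : partialDeriv b i F u = partialDeriv b i F' u := by
  simp only [partialDeriv, h.fderiv_eq]

theorem contDiffAt_partialDeriv (b : Module.Basis κ ℝ E) (i : κ) {F : E → W} {u : E}
    (hF : ContDiffAt ℝ ∞ F u) : ContDiffAt ℝ ∞ (partialDeriv b i F) u := by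
  have : ContDiffAt ℝ ∞ (fderiv ℝ F) u := hF.fderiv_right (m := ∞) (by simp)
  exact this.clm_apply contDiffAt_const

theorem partialDeriv_comm (b : Module.Basis κ ℝ E) (i j : κ) {F : E → W} {u : E}
    (hF : ContDiffAt ℝ ∞ F u) :
    partialDeriv b i (partialDeriv b j F) u = partialDeriv b j (partialDeriv b i F) u := by
  have hd : DifferentiableAt ℝ (fderiv ℝ F) u :=
    (hF.fderiv_right (m := ∞) (by simp)).differentiableAt (by simp)
  have h (k l : κ) : partialDeriv b k (partialDeriv b l F) u
      = fderiv ℝ (fderiv ℝ F) u (b k) (b l) := by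
    have := (hd.hasFDerivAt.clm_apply (hasFDerivAt_const (b l) u)).fderiv
    have h2 : partialDeriv b l F = fun w => fderiv ℝ F w (b l) := rfl
    rw [h2, EquiAffine.partialDeriv, this]
    simp
  rw [h, h]
  have h2 : (2 : WithTop ℕ∞) ≤ ∞ := WithTop.coe_le_coe.2 (le_top : (2 : ℕ∞) ≤ ⊤)
  exact (hF.isSymmSndFDerivAt (by simpa using h2)).eq _ _

variable [Fintype κ] [DecidableEq κ] [Fintype ι]

theorem hMatrix_isSymm (b : Module.Basis κ ℝ E) (c : Option κ ≃ ι) {X : E → ι → ℝ} {u : E}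
    (hX : ContDiffAt ℝ ∞ X u) : (hMatrix b c X u).transpose = hMatrix b c X u := by
  ext i j
  rw [Matrix.transpose_apply, hMatrix_apply, hMatrix_apply, partialDeriv_comm b i j hX]

theorem differentiableAt_frameDet (b : Module.Basis κ ℝ E) (c : Option κ ≃ ι) {X : E → ι → ℝ}
    {v : E → ι → ℝ} {u : E} (hX : ContDiffAt ℝ ∞ X u) (hv : DifferentiableAt ℝ v u) :
    DifferentiableAt ℝ (fun w => frameDet b c X w (v w)) u := by
  simp only [frameDet_apply]
  refine differentiableAt_det fun k l => ?_
  cases l with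
  | none => exact differentiableAt_pi.1 hv (c k)
  | some m =>
    exact differentiableAt_pi.1 ((contDiffAt_partialDeriv b m hX).differentiableAt (by simp)) (c k)

theorem differentiableAt_hMatrix (b : Module.Basis κ ℝ E) (c : Option κ ≃ ι) {X : E → ι → ℝ}
    {u : E} (hX : ContDiffAt ℝ ∞ X u) (i j : κ) :
    DifferentiableAt ℝ (fun w => hMatrix b c X w i j) u := by
  simp only [hMatrix_apply]
  exact differentiableAt_frameDet b c hX
    ((contDiffAt_partialDeriv b i (contDiffAt_partialDeriv b j hX)).differentiableAt (by simp))

end PartialDeriv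

/-! ### The normal component of the Laplacian -/

section Normal

variable {E : Type*} [NormedAddCommGroup E] [NormedSpace ℝ E]
  {κ ι : Type*} [Fintype κ] [DecidableEq κ] [Fintype ι]

/-- The weight `|det h|^(-1/(n+2))` is `ρ⁻¹` as soon as `|det h| = ρ^(n+2)`. -/
theorem blaschkeMatrix_eq (b : Module.Basis κ ℝ E) (c : Option κ ≃ ι) {X : E → ι → ℝ} {u : E}
    {ρ : ℝ} (hρ : 0 < ρ) (h : |(hMatrix b c X u).det| = ρ ^ (Fintype.card κ + 2)) :
    blaschkeMatrix b c X u = ρ⁻¹ • hMatrix b c X u := by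
  have hn : (Fintype.card κ : ℝ) + 2 ≠ 0 := by positivity
  rw [blaschkeMatrix, h, ← Real.rpow_natCast, ← Real.rpow_mul hρ.le]
  have : (((Fintype.card κ + 2 : ℕ) : ℝ) * (-1 / ((Fintype.card κ : ℝ) + 2))) = -1 := by
    push_cast; field_simp
  rw [this, Real.rpow_neg_one]

theorem exists_pos_pow_eq {x : ℝ} (hx : 0 < x) {m : ℕ} (hm : m ≠ 0) : ∃ ρ, 0 < ρ ∧ x = ρ ^ m :=
  ⟨x ^ (m : ℝ)⁻¹, by positivity, (Real.rpow_inv_natCast_pow hx.le hm).symm⟩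

/-- The derivatives of the coefficients of the Laplacian multiply first derivatives of `X`, which are
tangent, so that only the second derivatives contribute to the normal component. -/
theorem frameDet_laplacian (b : Module.Basis κ ℝ E) (c : Option κ ≃ ι)
    {g : E → Matrix κ κ ℝ} {X : E → ι → ℝ} {u : E} (hX : ContDiffAt ℝ ∞ X u)
    (hg : ∀ i j, DifferentiableAt ℝ (fun w => g w i j) u) (hdet : (g u).det ≠ 0) :
    frameDet b c X u (laplacian b g X u) =
      ∑ i, ∑ j, (g u)⁻¹ i j * hMatrix b c X u i j := by
  have hs : Real.sqrt |(g u).det| ≠ 0 := (Real.sqrt_pos.2 (abs_pos.2 hdet)).ne'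
  have key (i j : κ) : frameDet b c X u (partialDeriv b i (fun w => (Real.sqrt |(g w).det| *
      (g w)⁻¹ i j) • partialDeriv b j X w) u)
      = Real.sqrt |(g u).det| * ((g u)⁻¹ i j * hMatrix b c X u i j) := by
    have h1 : DifferentiableAt ℝ (fun w => Real.sqrt |(g w).det| * (g w)⁻¹ i j) u :=
      (((differentiableAt_det hg).abs hdet).sqrt (abs_ne_zero.2 hdet)).mul
        (differentiableAt_inv_apply hg hdet i j)
    have h2 : DifferentiableAt ℝ (partialDeriv b j X) u :=
      (contDiffAt_partialDeriv b j hX).differentiableAt (by simp)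
    rw [partialDeriv, fderiv_fun_smul h1 h2]
    simp only [add_apply, smul_apply,
      ContinuousLinearMap.smulRight_apply, map_add, map_smul, frameDet_partialDeriv, hMatrix_apply,
      smul_eq_mul, mul_zero, add_zero]
    rw [mul_assoc]; rfl
  simp only [laplacian, map_smul, map_sum, key, smul_eq_mul, ← Finset.mul_sum]
  rw [inv_mul_cancel_left₀ hs]

theorem sum_inv_mul_self {g : Matrix κ κ ℝ} (hg : g.transpose = g) (hdet : g.det ≠ 0) :
    ∑ i, ∑ j, g⁻¹ i j * g i j = Fintype.card κ := by
  have h1 : g⁻¹ * g = 1 := Matrix.nonsing_inv_mul g (isUnit_iff_ne_zero.2 hdet)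
  have h2 : ∀ i, ∑ j, g⁻¹ i j * g i j = 1 := by
    intro i
    have := congrFun (congrFun h1 i) i
    rw [Matrix.mul_apply, Matrix.one_apply_eq] at this
    rw [← this]
    refine Finset.sum_congr rfl fun j _ => ?_
    rw [← hg, Matrix.transpose_apply, hg]
  simp [h2]

theorem differentiableAt_blaschkeMatrix (b : Module.Basis κ ℝ E) (c : Option κ ≃ ι)
    {X : E → ι → ℝ} {u : E} (hX : ContDiffAt ℝ ∞ X u) (hdet : (hMatrix b c X u).det ≠ 0)
    (i j : κ) : DifferentiableAt ℝ (fun w => blaschkeMatrix b c X w i j) u := by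
  simp only [blaschkeMatrix, Matrix.smul_apply, smul_eq_mul]
  exact (((differentiableAt_det (differentiableAt_hMatrix b c hX)).abs hdet).rpow_const
    (Or.inl (abs_ne_zero.2 hdet))).mul
    (differentiableAt_hMatrix b c hX i j)

end Normal

/-! ### Proper affine hyperspheres centred at the origin, in a chart -/

section Centred

variable {E : Type*} [NormedAddCommGroup E] [NormedSpace ℝ E]
  {κ ι : Type*} [Fintype κ] [DecidableEq κ] [Nonempty κ] [Fintype ι]

/-- The sign that relates a continuous affine metric to the Blaschke matrix is locally constant,
since it can be read off from a nonzero entry. -/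
theorem eventually_eq_smul_of_eq_or_eq_neg {S : Type*} [TopologicalSpace S] {U : Set S}
    (hU : IsOpen U) {g β : S → Matrix κ κ ℝ}
    (hg : ContinuousOn g U) (hβ : ContinuousOn β U) (hgβ : ∀ u ∈ U, g u = β u ∨ g u = -β u)
    {u : S} (hu : u ∈ U) (hdet : (β u).det ≠ 0) :
    ∃ ε : ℝ, (ε = 1 ∨ ε = -1) ∧ ∀ᶠ w in nhds u, g w = ε • β w := by
  obtain ⟨i, j, hij⟩ : ∃ i j, β u i j ≠ 0 := by
    by_contra! h
    exact hdet (by rw [show β u = 0 from Matrix.ext h, Matrix.det_zero])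
  have hUn := hU.mem_nhds hu
  have e (A : S → Matrix κ κ ℝ) (hA : ContinuousOn A U) : ContinuousAt (fun w => A w i j) u :=
    (continuous_id.matrix_elem i j).continuousAt.comp (hA.continuousAt hUn)
  have hc : ContinuousAt (fun w => g w i j * β w i j) u := (e g hg).mul (e β hβ)
  have hpos : 0 < β u i j * β u i j := mul_self_pos.2 hij
  rcases hgβ u hu with h | h
  · refine ⟨1, Or.inl rfl, ?_⟩
    filter_upwards [hUn, Filter.Tendsto.eventually_const_lt
      (show 0 < g u i j * β u i j by rw [h]; exact hpos) hc]
      with w hw hw0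
    rcases hgβ w hw with h' | h'
    · simp [h']
    · rw [h', Matrix.neg_apply] at hw0
      nlinarith [mul_self_nonneg (β w i j)]
  · refine ⟨-1, Or.inr rfl, ?_⟩
    filter_upwards [hUn, Filter.Tendsto.eventually_lt_const
      (show g u i j * β u i j < 0 by rw [h, Matrix.neg_apply]; linarith) hc]
      with w hw hw0
    rcases hgβ w hw with h' | h'
    · rw [h'] at hw0
      nlinarith [mul_self_nonneg (β w i j)]
    · simp [h']

/-- If `(1/n) Δ_g X = Λ X` for the affine metric `g` of `X`, then the position vector is transverse
and `g` is the second fundamental form of `X` with respect to the transverse field `Λ X`, whose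
induced volume is that of `g`. This results from comparing normal components. -/
theorem frameDet_self_of_laplacian_eq (b : Module.Basis κ ℝ E) (c : Option κ ≃ ι) {U : Set E}
    (hU : IsOpen U) {X : E → ι → ℝ} (hX : ContDiffOn ℝ ∞ X U) {g : E → Matrix κ κ ℝ}
    (hg : ContinuousOn g U)
    (hgβ : ∀ u ∈ U, (hMatrix b c X u).det ≠ 0 ∧
      (g u = blaschkeMatrix b c X u ∨ g u = -blaschkeMatrix b c X u))
    {Λ : ℝ} {u : E} (hu : u ∈ U)
    (hlap : (Fintype.card κ : ℝ)⁻¹ • laplacian b g X u = Λ • X u) :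
    frameDet b c X u (X u) ≠ 0 ∧
      hMatrix b c X u = (Λ * frameDet b c X u (X u)) • g u ∧
      |(g u).det| = (Λ * frameDet b c X u (X u)) ^ 2 := by
  have hXu (w) (hw : w ∈ U) : ContDiffAt ℝ ∞ X w := hX.contDiffAt (hU.mem_nhds hw)
  have hβd (w) (hw : w ∈ U) := differentiableAt_blaschkeMatrix b c (hXu w hw) (hgβ w hw).1
  have hβc : ContinuousOn (blaschkeMatrix b c X) U := by
    intro w hw
    refine ContinuousAt.continuousWithinAt (continuousAt_pi.2 fun i => continuousAt_pi.2 fun j => ?_)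
    exact (hβd w hw i j).continuousAt
  have hdet := (hgβ u hu).1
  obtain ⟨ρ, hρ, hρh⟩ := exists_pos_pow_eq (abs_pos.2 hdet) (m := Fintype.card κ + 2) (by omega)
  have hβ := blaschkeMatrix_eq b c hρ hρh
  have hβdet : (blaschkeMatrix b c X u).det ≠ 0 := by
    rw [hβ, Matrix.det_smul]; positivity
  obtain ⟨ε, hε, hgε⟩ := eventually_eq_smul_of_eq_or_eq_neg hU hg hβc (fun w hw => (hgβ w hw).2) hu
    hβdet
  have hεε : ε * ε = 1 := by rcases hε with h | h <;> simp [h]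
  have hε0 : ε ≠ 0 := by rintro rfl; simp at hεε
  have hgu := hgε.self_of_nhds
  have hgd (i j : κ) : DifferentiableAt ℝ (fun w => g w i j) u := by
    refine DifferentiableAt.congr_of_eventuallyEq ((hβd u hu i j).const_mul ε) ?_
    filter_upwards [hgε] with w hw
    rw [hw]; rfl
  have hgdet : (g u).det ≠ 0 := by
    rw [hgu, Matrix.det_smul]; exact mul_ne_zero (pow_ne_zero _ hε0) hβdet
  have hh : hMatrix b c X u = (ε * ρ) • g u := by
    rw [hgu, hβ, smul_smul, smul_smul]
    rw [show ε * ρ * ε * ρ⁻¹ = (ε * ε) * (ρ * ρ⁻¹) by ring, hεε, mul_inv_cancel₀ hρ.ne']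
    simp
  have hgs : (g u).transpose = g u := by
    rw [hgu, hβ, Matrix.transpose_smul, Matrix.transpose_smul, hMatrix_isSymm b c (hXu u hu)]
  have hn : (Fintype.card κ : ℝ) ≠ 0 := by simp
  -- The normal component of `Δ_g X` is the trace of `h = ε ρ g` with respect to `g`.
  have hD : Λ * frameDet b c X u (X u) = ε * ρ := by
    have h1 := congrArg (frameDet b c X u) hlap
    rw [map_smul, map_smul, frameDet_laplacian b c (hXu u hu) hgd hgdet, hh] at h1
    simp only [Matrix.smul_apply, smul_eq_mul, mul_left_comm _ (ε * ρ), ← Finset.mul_sum] at h1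
    rw [sum_inv_mul_self hgs hgdet] at h1
    rw [← h1]; field_simp
  have habs : |ε| = 1 := by rcases hε with h | h <;> simp [h]
  refine ⟨fun h0 => ?_, by rw [hD]; exact hh, ?_⟩
  · rw [h0, mul_zero] at hD
    exact mul_ne_zero hε0 hρ.ne' hD.symm
  · have h1 := hρh
    rw [hh, Matrix.det_smul, abs_mul, abs_pow, abs_mul, habs, one_mul, abs_of_pos hρ, pow_add] at h1
    rw [hD, mul_pow, sq ε, hεε, one_mul]
    exact mul_left_cancel₀ (pow_ne_zero _ hρ.ne') h1

/-- A map whose values near `u` lie on a line is degenerate at `u`. -/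
theorem det_hMatrix_eq_zero_of_eventually_mem_span (b : Module.Basis κ ℝ E) (c : Option κ ≃ ι)
    {U : Set E} (hU : IsOpen U) {X : E → ι → ℝ} (hX : ContDiffOn ℝ ∞ X U) {u : E} (hu : u ∈ U)
    (v : ι → ℝ) (h : ∀ᶠ w in nhds u, X w ∈ Submodule.span ℝ {v}) : (hMatrix b c X u).det = 0 := by
  -- The target has dimension at least two, so that some functional vanishes on the line.
  obtain ⟨ψ, hψ0, hψv⟩ : ∃ ψ : (ι → ℝ) →ₗ[ℝ] ℝ, ψ ≠ 0 ∧ ψ v = 0 := by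
    obtain ⟨k⟩ := ‹Nonempty κ›
    classical
    set i := c none
    set j := c (some k)
    have hij : i ≠ j := fun h => by simpa using c.injective h
    by_cases hv : v i = 0
    · refine ⟨LinearMap.proj i, fun h => ?_, hv⟩
      simpa using LinearMap.congr_fun h (Pi.single i 1)
    · refine ⟨v i • LinearMap.proj j - v j • LinearMap.proj i, fun h => hv ?_, ?_⟩
      · simpa [hij] using LinearMap.congr_fun h (Pi.single j 1)
      · simp [mul_comm]
  let Ψ : (ι → ℝ) →L[ℝ] ℝ := LinearMap.toContinuousLinearMap ψ
  have step (F : E → ι → ℝ) (m : κ) (w : E) (hF : DifferentiableAt ℝ F w)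
      (h0 : ∀ᶠ w in nhds w, ψ (F w) = 0) : ψ (partialDeriv b m F w) = 0 := by
    have h1 : Ψ ∘ F =ᶠ[nhds w] fun _ => 0 := h0
    have h2 := (Ψ.hasFDerivAt.comp w hF.hasFDerivAt).fderiv
    rw [h1.fderiv_eq, fderiv_fun_const] at h2
    exact (DFunLike.congr_fun h2 (b m)).symm
  have hX' : ∀ᶠ w in nhds u, ContDiffAt ℝ ∞ X w := by
    filter_upwards [hU.mem_nhds hu] with w hw using hX.contDiffAt (hU.mem_nhds hw)
  have hψX : ∀ᶠ w in nhds u, ψ (X w) = 0 := by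
    filter_upwards [h] with w hw
    obtain ⟨a, ha⟩ := Submodule.mem_span_singleton.1 hw
    rw [← ha, map_smul, hψv, smul_zero]
  have h1 (m : κ) : ∀ᶠ w in nhds u, ψ (partialDeriv b m X w) = 0 := by
    filter_upwards [hψX.eventually_nhds, hX'] with w hw hw'
    exact step X m w (hw'.differentiableAt (by simp)) hw
  have h2 (i j : κ) : ψ (partialDeriv b i (partialDeriv b j X) u) = 0 :=
    step _ i u ((contDiffAt_partialDeriv b j hX'.self_of_nhds).differentiableAt (by simp)) (h1 j)
  obtain ⟨y, hy⟩ : ∃ y, ψ y ≠ 0 := by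
    by_contra! h
    exact hψ0 (LinearMap.ext h)
  have h3 : hMatrix b c X u = 0 := by
    ext i j
    have := apply_mul_frameDet b c X u ψ (fun m => (h1 m).self_of_nhds)
      (partialDeriv b i (partialDeriv b j X) u) y
    rw [h2, zero_mul] at this
    rw [hMatrix_apply]
    exact (mul_eq_zero.1 this.symm).resolve_left hy
  rw [h3, Matrix.det_zero]

end Centred

/-! ### Weighted orthogonal systems -/

section Orthogonal

variable {A T : Type*} [Fintype A] [DecidableEq A] [DecidableEq T] {W : A → ℝ}
  {lam : A → T → ℝ} {q : T → ℝ}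

/-- The square matrix with the columns `lam · l` and the constant column `1`. -/
noncomputable def augment (lam : A → T → ℝ) : Matrix A (Option T) ℝ :=
  Matrix.of fun a o => o.elim 1 (lam a)

theorem augment_gram (h0 : ∀ l, ∑ a, W a * lam a l = 0)
    (h1 : ∀ l m, ∑ a, W a * lam a l * lam a m = if l = m then q l else 0) :
    (augment lam).transpose * Matrix.diagonal W * augment lam =
      Matrix.diagonal fun o : Option T => o.elim (∑ a, W a) q := by
  ext i j
  rw [Matrix.mul_apply]
  simp only [Matrix.mul_diagonal, Matrix.transpose_apply, augment, Matrix.of_apply,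
    Matrix.diagonal_apply]
  rcases i with _ | l <;> rcases j with _ | m
  · simp
  · simpa using h0 m
  · simpa [mul_comm] using h0 l
  · simpa [mul_comm, mul_left_comm, mul_assoc] using h1 l m

variable [Fintype T]

theorem det_augment_sq (e : A ≃ Option T) (h0 : ∀ l, ∑ a, W a * lam a l = 0)
    (h1 : ∀ l m, ∑ a, W a * lam a l * lam a m = if l = m then q l else 0) :
    ((augment lam).submatrix id e).det ^ 2 * ∏ a, W a = (∑ a, W a) * ∏ l, q l := by
  have h := congrArg Matrix.det (congrArg (fun M => M.submatrix e e) (augment_gram h0 h1))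
  have h2 : ((augment lam).transpose * Matrix.diagonal W * augment lam).submatrix e e =
      ((augment lam).submatrix id e).transpose * Matrix.diagonal W *
        (augment lam).submatrix id e := by
    ext i j; simp [Matrix.mul_apply]
  rw [h2, Matrix.det_mul, Matrix.det_mul, Matrix.det_transpose, Matrix.det_diagonal,
    Matrix.det_submatrix_equiv_self, Matrix.det_diagonal, Fintype.prod_option] at h
  simp only [Option.elim_none, Option.elim_some] at h
  rw [← h]; ring

/-- Bessel's equality: the orthogonal system `1, lam · l` is a basis of the weighted space. -/
theorem sum_lam_mul_lam_div (e : A ≃ Option T) (hS : ∑ a, W a ≠ 0) (hq : ∀ l, q l ≠ 0)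
    (h0 : ∀ l, ∑ a, W a * lam a l = 0)
    (h1 : ∀ l m, ∑ a, W a * lam a l * lam a m = if l = m then q l else 0) (a b : A) :
    (1 / (∑ a, W a) + ∑ l, lam a l * lam b l / q l) * W b = if a = b then 1 else 0 := by
  set q' : Option T → ℝ := fun o => o.elim (∑ a, W a) q
  have hq' : ∀ o, q' o ≠ 0 := by rintro (_ | l); exacts [hS, hq l]
  set Q := (augment lam).submatrix id e
  have hB : (Matrix.diagonal (fun k => (q' (e k))⁻¹) * (Q.transpose * Matrix.diagonal W)) * Q
      = 1 := by
    have h2 : Q.transpose * Matrix.diagonal W * Q = Matrix.diagonal (q' ∘ e) := by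
      rw [← Matrix.submatrix_diagonal_equiv, ← augment_gram h0 h1]
      ext i j; simp [Matrix.mul_apply, Q]
    rw [Matrix.mul_assoc, h2, Matrix.diagonal_mul_diagonal]
    simp [hq']
  rw [mul_eq_one_comm] at hB
  have h3 := congrFun (congrFun hB a) b
  rw [Matrix.mul_apply, Matrix.one_apply] at h3
  rw [← h3, add_mul, Finset.sum_mul]
  refine Eq.trans ?_ (e.symm.sum_comp _)
  rw [Fintype.sum_option]
  congr 1
  · simp [Matrix.diagonal_mul, Q, augment, q']
  · refine Finset.sum_congr rfl fun l _ => ?_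
    simp [Matrix.diagonal_mul, Q, augment, q']
    ring

theorem eq_weighted_mean_add (e : A ≃ Option T) (hS : ∑ a, W a ≠ 0) (hq : ∀ l, q l ≠ 0)
    (h0 : ∀ l, ∑ a, W a * lam a l = 0)
    (h1 : ∀ l m, ∑ a, W a * lam a l * lam a m = if l = m then q l else 0) (v : A → ℝ) (a : A) :
    v a = (∑ b, W b * v b) / (∑ a, W a) + ∑ l, lam a l * ((∑ b, W b * lam b l * v b) / q l) := by
  have h2 : v a = ∑ b, (if a = b then 1 else 0) * v b := by simp
  rw [h2]
  simp only [← sum_lam_mul_lam_div e hS hq h0 h1 a, add_mul, Finset.sum_add_distrib,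
    Finset.sum_div, Finset.sum_mul, Finset.mul_sum]
  congr 1
  · exact Finset.sum_congr rfl fun b _ => by ring
  · rw [Finset.sum_comm]
    exact Finset.sum_congr rfl fun l _ => Finset.sum_congr rfl fun b _ => by ring

end Orthogonal

/-! ### The exponents of the composition -/

section Exponents

/-- The coefficient of the variable with index `l` in the exponent of `expFactor N · a`. -/
noncomputable def expCoeff {K : ℕ} (N : Fin K → ℕ) (a : Fin K) (l : Fin (K - 1)) : ℝ :=
  -(if l.val + 1 = a.val then 1 / ((N a : ℝ) + 1) else 0) +
    if a.val ≤ l.val then 1 / (partialSum N (l.val + 1) : ℝ) else 0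

theorem expFactor_eq {K : ℕ} (N : Fin K → ℕ) (t : Fin (K - 1) → ℝ) (a : Fin K) :
    expFactor N t a = Real.exp (∑ l, expCoeff N a l * t l) := by
  rw [expFactor]
  congr 1
  simp only [expCoeff, add_mul, Finset.sum_add_distrib, neg_mul, Finset.sum_neg_distrib,
    Finset.sum_filter, ite_mul, zero_mul, one_div_mul_eq_div]

/-- The weighted square length `∑ W_a (expCoeff N a l)²`, in closed form. -/
noncomputable def expNorm {K : ℕ} (N : Fin K → ℕ) (l : Fin (K - 1)) : ℝ :=
  (partialSum N (l.val + 2) : ℝ) /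
    ((partialSum N (l.val + 1) : ℝ) * ((N ⟨l.val + 1, by omega⟩ : ℝ) + 1))

theorem partialSum_pos {k : ℕ} (N : Fin (k + 1) → ℕ) (m : ℕ) :
    (0 : ℝ) < partialSum N (m + 1) := by
  have : 0 < partialSum N (m + 1) :=
    Finset.sum_pos (fun _ _ => Nat.succ_pos _) ⟨0, by simp⟩
  exact_mod_cast this

theorem partialSum_succ {k : ℕ} (N : Fin (k + 1) → ℕ) (l : Fin k) :
    partialSum N (l.val + 2) = partialSum N (l.val + 1) + (N l.succ + 1) := by
  have : (Finset.univ.filter fun a : Fin (k + 1) => a.val < l.val + 2) =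
      insert l.succ (Finset.univ.filter fun a : Fin (k + 1) => a.val < l.val + 1) := by
    ext a
    simp only [Finset.mem_filter, Finset.mem_univ, true_and, Finset.mem_insert, Fin.ext_iff,
      Fin.val_succ]
    omega
  rw [partialSum, this, Finset.sum_insert (by simp), partialSum]
  ring

theorem expNorm_pos {K : ℕ} (N : Fin K → ℕ) (l : Fin (K - 1)) : 0 < expNorm N l := by
  obtain _ | k := K
  · exact l.elim0
  · have := partialSum_pos N (l.val + 1)
    have := partialSum_pos N l.val
    unfold expNorm
    positivity

theorem sum_mul_expCoeff_mul {k : ℕ} (N : Fin (k + 1) → ℕ) (l : Fin k) (v : Fin (k + 1) → ℝ) :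
    ∑ a, ((N a : ℝ) + 1) * expCoeff N a l * v a =
      (∑ a with a.val < l.val + 1, ((N a : ℝ) + 1) * v a) / partialSum N (l.val + 1)
        - v l.succ := by
  have h1 : ∀ a, ((N a : ℝ) + 1) * expCoeff N a l * v a =
      (if a.val < l.val + 1 then ((N a : ℝ) + 1) * v a else 0) / partialSum N (l.val + 1)
        - if l.succ = a then v a else 0 := by
    intro a
    have h2 : l.succ = a ↔ l.val + 1 = a.val := by simp [Fin.ext_iff]
    have h3 : a.val < l.val + 1 ↔ a.val ≤ l.val := Nat.lt_succ_iff
    have h4 : ((N a : ℝ) + 1) ≠ 0 := by positivity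
    simp only [expCoeff, h2, h3]
    split_ifs <;> field_simp <;> ring
  simp only [h1, Finset.sum_sub_distrib, ← Finset.sum_div, Finset.sum_filter]
  simp

theorem sum_mul_expCoeff {K : ℕ} (N : Fin K → ℕ) (l : Fin (K - 1)) :
    ∑ a, ((N a : ℝ) + 1) * expCoeff N a l = 0 := by
  obtain _ | k := K
  · exact l.elim0
  · have h := sum_mul_expCoeff_mul N l 1
    simp only [Pi.one_apply, mul_one] at h
    have h2 : (∑ a with a.val < l.val + 1, ((N a : ℝ) + 1)) = partialSum N (l.val + 1) := by
      simp [partialSum]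
    rw [h, h2, div_self (partialSum_pos N l.val).ne', sub_self]

theorem sum_mul_expCoeff_mul_expCoeff {K : ℕ} (N : Fin K → ℕ) (l m : Fin (K - 1)) :
    ∑ a, ((N a : ℝ) + 1) * expCoeff N a l * expCoeff N a m =
      if l = m then expNorm N l else 0 := by
  obtain _ | k := K
  · exact l.elim0
  change Fin k at l m
  have hsum (i : Fin k) : (∑ a with a.val < i.val + 1, ((N a : ℝ) + 1)) =
      partialSum N (i.val + 1) := by
    simp [partialSum]
  have key (i j : Fin k) (hij : i.val ≤ j.val) :
      ∑ a, ((N a : ℝ) + 1) * expCoeff N a i * expCoeff N a j =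
        if i = j then expNorm N i else 0 := by
    have hi := (partialSum_pos N i.val).ne'
    have h1 : (∑ a with a.val < i.val + 1, ((N a : ℝ) + 1) * expCoeff N a j) =
        partialSum N (i.val + 1) / partialSum N (j.val + 1) := by
      rw [← hsum i, Finset.sum_div]
      refine Finset.sum_congr rfl fun a ha => ?_
      rw [Finset.mem_filter] at ha
      have h2 : ¬ (j.val + 1 = a.val) := by omega
      have h3 : a.val ≤ j.val := by omega
      simp [expCoeff, h2, h3, div_eq_mul_inv]
    rw [sum_mul_expCoeff_mul N i fun a => expCoeff N a j, h1]
    rcases hij.lt_or_eq with h | h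
    · have h2 : i.val + 1 ≤ j.val := h
      have h3 : ¬ (j.val + 1 = i.val + 1) := by omega
      have h4 : ¬ (i = j) := by rintro rfl; omega
      have := (partialSum_pos N j.val).ne'
      simp only [expCoeff, Fin.val_succ, h2, h3, h4, if_true, if_false]
      field_simp
      simp
    · obtain rfl : i = j := Fin.ext h
      have h4 : ((N i.succ : ℝ) + 1) ≠ 0 := by positivity
      have h5 : (partialSum N (i.val + 2) : ℝ) = partialSum N (i.val + 1) + (N i.succ + 1) := by
        exact_mod_cast partialSum_succ N i
      have h6 : expNorm N i = (partialSum N (i.val + 2) : ℝ) /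
        ((partialSum N (i.val + 1) : ℝ) * ((N i.succ : ℝ) + 1)) := rfl
      rw [if_pos rfl, h6, h5]
      simp only [expCoeff, Fin.val_succ, if_true, Nat.succ_le_iff, lt_irrefl, if_false]
      field_simp
      ring
  rcases le_total l.val m.val with h | h
  · exact key l m h
  · simp only [mul_right_comm _ (expCoeff N _ l), key m l h, eq_comm (a := l)]
    split_ifs with h
    · rw [h]
    · rfl

theorem prod_expNorm_mul_prod {K : ℕ} (hK : 0 < K) (N : Fin K → ℕ) :
    (∏ l, expNorm N l) * ∏ a, ((N a : ℝ) + 1) = ∑ a, ((N a : ℝ) + 1) := by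
  obtain _ | k := K
  · omega
  have h1 : ∏ l : Fin k, (partialSum N (l.val + 2) : ℝ) / (partialSum N (l.val + 1) : ℝ) =
      partialSum N (k + 1) / partialSum N 1 := by
    rw [Fin.prod_univ_eq_prod_range
      (fun l => (partialSum N (l + 2) : ℝ) / (partialSum N (l + 1) : ℝ)) k]
    refine Finset.prod_range_induction _ (fun m => (partialSum N (m + 1) : ℝ) / partialSum N 1)
      (div_self (partialSum_pos N 0).ne') _ fun m _ => ?_
    have := (partialSum_pos N m).ne'
    field_simp
  have h2 (l : Fin k) : expNorm N l = (partialSum N (l.val + 2) : ℝ) /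
      (partialSum N (l.val + 1) : ℝ) * ((N l.succ : ℝ) + 1)⁻¹ := by
    rw [← div_eq_mul_inv, div_div]; rfl
  have h3 : (partialSum N (k + 1) : ℝ) = ∑ a, ((N a : ℝ) + 1) := by
    simp [partialSum, Fin.is_le]
  have h4 : (partialSum N 1 : ℝ) = (N 0 : ℝ) + 1 := by
    have : (Finset.univ.filter fun a : Fin (k + 1) => a.val < 1) = {0} := by
      ext a
      simp only [Finset.mem_filter, Finset.mem_univ, true_and, Finset.mem_singleton, Fin.ext_iff,
        Fin.val_zero]
      omega
    rw [partialSum, this]; simp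
  have h5 : ∏ l : Fin k, ((N l.succ : ℝ) + 1) ≠ 0 :=
    Finset.prod_ne_zero_iff.2 fun l _ => by positivity
  have h6 : ((N 0 : ℝ) + 1) ≠ 0 := by positivity
  change (∏ l : Fin k, expNorm N l) * _ = _
  rw [Finset.prod_congr rfl fun l _ => h2 l, Finset.prod_mul_distrib, h1, h3, h4,
    Fin.prod_univ_succ, Finset.prod_inv_distrib]
  field_simp

end Exponents

/-! ### Derivatives of the composition in linear coordinates -/

section Composition

variable {r s : ℕ} {n : Fin s → ℕ}

/-- The factor to which a coordinate of the ambient space belongs. -/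
def blockIndex : AmbientIndex r n → Fin (r + s)
  | Sum.inl a => Fin.castAdd s a
  | Sum.inr i => Fin.natAdd r i.1

/-- The inclusion of the block `ℝ^(n_α + 1)` into the ambient space. -/
def blockEmbed (r : ℕ) (n : Fin s → ℕ) (α : Fin s) :
    (Fin (n α + 1) → ℝ) →ₗ[ℝ] (AmbientIndex r n → ℝ) where
  toFun v := Sum.elim 0 fun i => (Pi.single α v : ∀ β, Fin (n β + 1) → ℝ) i.1 i.2
  map_add' v w := by
    ext (a | ⟨β, k⟩)
    · simp
    · simp [Pi.single_add]
  map_smul' a v := by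
    ext (a | ⟨β, k⟩)
    · simp
    · simp [Pi.single_smul]

@[simp]
theorem blockEmbed_inl (α : Fin s) (v : Fin (n α + 1) → ℝ) (a : Fin r) :
    blockEmbed r n α v (Sum.inl a) = 0 := rfl

@[simp]
theorem blockEmbed_same (α : Fin s) (v : Fin (n α + 1) → ℝ) (k : Fin (n α + 1)) :
    blockEmbed r n α v (Sum.inr ⟨α, k⟩) = v k := by
  simp [blockEmbed]

theorem blockEmbed_ne {α β : Fin s} (h : β ≠ α) (v : Fin (n α + 1) → ℝ) (k : Fin (n β + 1)) :
    blockEmbed r n α v (Sum.inr ⟨β, k⟩) = 0 := by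
  simp [blockEmbed, h]

theorem compBasis_inl (l : Fin (r + s - 1)) :
    compBasis r n (Sum.inl l) = (EuclideanSpace.single l 1, 0) := by
  simp [compBasis, stdBasis]

theorem compBasis_inr (α : Fin s) (m : Fin (n α)) :
    compBasis r n (Sum.inr ⟨α, m⟩) = (0, Pi.single α (EuclideanSpace.single m 1)) := by
  simp [compBasis, stdBasis]

theorem expFactor_add_smul {K : ℕ} (N : Fin K → ℕ) (t : EuclideanSpace ℝ (Fin (K - 1)))
    (l : Fin (K - 1)) (σ : ℝ) (a : Fin K) :
    expFactor N (t + σ • EuclideanSpace.single l (1 : ℝ) : EuclideanSpace ℝ (Fin (K - 1))) a =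
      Real.exp (expCoeff N a l * σ) * expFactor N t a := by
  rw [expFactor_eq, expFactor_eq, ← Real.exp_add]
  congr 1
  simp [mul_add, Finset.sum_add_distrib, add_comm]

theorem contDiff_expFactor {K : ℕ} (N : Fin K → ℕ) (a : Fin K) :
    ContDiff ℝ ∞ fun t : EuclideanSpace ℝ (Fin (K - 1)) => expFactor N t a := by
  simp only [expFactor_eq]
  fun_prop

theorem expFactor_pos {K : ℕ} (N : Fin K → ℕ) (t : Fin (K - 1) → ℝ) (a : Fin K) :
    0 < expFactor N t a := Real.exp_pos _

section LineDerivative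

variable {W : Type*} [NormedAddCommGroup W] [NormedSpace ℝ W]

theorem partialDeriv_eq_of_hasDerivAt {E κ : Type*} [NormedAddCommGroup E] [NormedSpace ℝ E]
    (b : Module.Basis κ ℝ E) (i : κ) {F : E → W} {u : E} {F' : W} (hF : DifferentiableAt ℝ F u)
    (h : HasDerivAt (fun σ : ℝ => F (u + σ • b i)) F' 0) : partialDeriv b i F u = F' := by
  rw [partialDeriv, ← hF.lineDeriv_eq_fderiv]
  exact h.deriv

/-- The derivative in the direction of a Euclidean variable `t_l`, of a map each component of which
depends on `t_l` through the exponential of its block only. -/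
theorem partialDeriv_inl_eq
    {F : EuclideanSpace ℝ (Fin (r + s - 1)) × (∀ α, EuclideanSpace ℝ (Fin (n α))) →
      AmbientIndex r n → ℝ}
    {w : EuclideanSpace ℝ (Fin (r + s - 1)) × (∀ α, EuclideanSpace ℝ (Fin (n α)))}
    (l : Fin (r + s - 1)) (hF : DifferentiableAt ℝ F w)
    (h : ∀ (σ : ℝ) i, F (w + σ • compBasis r n (Sum.inl l)) i =
      Real.exp (expCoeff (factorDim r n) (blockIndex i) l * σ) * F w i) :
    partialDeriv (compBasis r n) (Sum.inl l) F w =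
      fun i => expCoeff (factorDim r n) (blockIndex i) l * F w i := by
  refine partialDeriv_eq_of_hasDerivAt _ _ hF (hasDerivAt_pi.2 fun i => ?_)
  simp only [h]
  have := ((hasDerivAt_id (0 : ℝ)).const_mul
    (expCoeff (factorDim r n) (blockIndex i) l)).exp.mul_const (F w i)
  simpa using this

/-- The derivative in a direction tangent to the factor with index `α`, of a map whose dependence
on the point of this factor is known. -/
theorem partialDeriv_inr_eq
    {F : EuclideanSpace ℝ (Fin (r + s - 1)) × (∀ α, EuclideanSpace ℝ (Fin (n α))) → W}
    {w : EuclideanSpace ℝ (Fin (r + s - 1)) × (∀ α, EuclideanSpace ℝ (Fin (n α)))}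
    {α : Fin s} (m : Fin (n α)) (hF : DifferentiableAt ℝ F w)
    {V : Type*} [NormedAddCommGroup V] [NormedSpace ℝ V] {Ψ : EuclideanSpace ℝ (Fin (n α)) → V}
    (hΨ : DifferentiableAt ℝ Ψ (w.2 α)) (C : W) (φ : V →L[ℝ] W)
    (h : ∀ σ : ℝ, F (w + σ • compBasis r n (Sum.inr ⟨α, m⟩)) =
      C + φ (Ψ (w.2 α + σ • stdBasis (n α) m))) :
    partialDeriv (compBasis r n) (Sum.inr ⟨α, m⟩) F w =
      φ (partialDeriv (stdBasis (n α)) m Ψ (w.2 α)) := by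
  refine partialDeriv_eq_of_hasDerivAt _ _ hF ?_
  simp only [h]
  have h1 : HasDerivAt (fun σ : ℝ => Ψ (w.2 α + σ • stdBasis (n α) m))
      (partialDeriv (stdBasis (n α)) m Ψ (w.2 α)) 0 :=
    hΨ.hasFDerivAt.hasLineDerivAt _
  exact (φ.hasFDerivAt.comp_hasDerivAt (0 : ℝ) h1).const_add C

end LineDerivative

variable (c : Fin (r + s) → ℝ) (Y : ∀ α, EuclideanSpace ℝ (Fin (n α)) → Fin (n α + 1) → ℝ)

theorem calabiComposition_inl {M : Fin s → Type*} (x : ∀ α, M α → Fin (n α + 1) → ℝ)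
    (w : CompDomain r M) (a : Fin r) : calabiComposition r n c x w (Sum.inl a) =
      c (Fin.castAdd s a) * expFactor (factorDim r n) w.1 (Fin.castAdd s a) := rfl

theorem calabiComposition_inr {M : Fin s → Type*} (x : ∀ α, M α → Fin (n α + 1) → ℝ)
    (w : CompDomain r M) (α : Fin s) (k : Fin (n α + 1)) :
    calabiComposition r n c x w (Sum.inr ⟨α, k⟩) =
      c (Fin.natAdd r α) * expFactor (factorDim r n) w.1 (Fin.natAdd r α) * x α (w.2 α) k := rfl

/-- The scalar `c_a e_a(t)` by which the block with index `a` is multiplied. -/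
noncomputable def blockScale (r : ℕ) (n : Fin s → ℕ) (c : Fin (r + s) → ℝ)
    (t : EuclideanSpace ℝ (Fin (r + s - 1))) (a : Fin (r + s)) : ℝ :=
  c a * expFactor (factorDim r n) t a

theorem contDiff_blockScale (a : Fin (r + s)) :
    ContDiff ℝ ∞ fun t => blockScale r n c t a :=
  contDiff_const.mul (contDiff_expFactor _ a)

theorem blockScale_add_smul (t : EuclideanSpace ℝ (Fin (r + s - 1))) (l : Fin (r + s - 1))
    (σ : ℝ) (a : Fin (r + s)) :
    blockScale r n c (t + σ • EuclideanSpace.single l (1 : ℝ)) a =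
      Real.exp (expCoeff (factorDim r n) a l * σ) * blockScale r n c t a := by
  rw [blockScale, expFactor_add_smul, blockScale]; ring

/-- The derivative of the composition along the factor with index `α`. -/
noncomputable def factorDeriv (α : Fin s) (m : Fin (n α)) :
    EuclideanSpace ℝ (Fin (r + s - 1)) × (∀ α, EuclideanSpace ℝ (Fin (n α))) →
      AmbientIndex r n → ℝ :=
  fun w => blockScale r n c w.1 (Fin.natAdd r α) •
    blockEmbed r n α (partialDeriv (stdBasis (n α)) m (Y α) (w.2 α))

/-- `blockEmbed` as a continuous linear map. -/
noncomputable def blockEmbedL (r : ℕ) (n : Fin s → ℕ) (α : Fin s) :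
    (Fin (n α + 1) → ℝ) →L[ℝ] (AmbientIndex r n → ℝ) :=
  LinearMap.toContinuousLinearMap (blockEmbed r n α)

theorem blockEmbedL_apply (α : Fin s) (v : Fin (n α + 1) → ℝ) :
    blockEmbedL r n α v = blockEmbed r n α v := rfl

variable {c Y} {w : EuclideanSpace ℝ (Fin (r + s - 1)) × (∀ α, EuclideanSpace ℝ (Fin (n α)))}

theorem contDiffAt_calabiComposition (hY : ∀ α, ContDiffAt ℝ ∞ (Y α) (w.2 α)) :
    ContDiffAt ℝ ∞ (calabiComposition r n c Y) w := by
  refine contDiffAt_pi.2 fun i => ?_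
  have h1 (a : Fin (r + s)) : ContDiffAt ℝ ∞
      (fun w : EuclideanSpace ℝ (Fin (r + s - 1)) × (∀ α, EuclideanSpace ℝ (Fin (n α))) =>
        blockScale r n c w.1 a) w := (contDiff_blockScale c a).contDiffAt.comp w contDiffAt_fst
  rcases i with a | ⟨α, k⟩
  · exact h1 _
  · refine (h1 (Fin.natAdd r α)).mul (contDiffAt_pi.1 ?_ k)
    exact (hY α).comp w (contDiffAt_pi.1 contDiffAt_snd α)

theorem contDiffAt_factorDeriv {α : Fin s} (hY : ContDiffAt ℝ ∞ (Y α) (w.2 α)) (m : Fin (n α)) :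
    ContDiffAt ℝ ∞ (factorDeriv c Y α m) w := by
  refine ((contDiff_blockScale c _).contDiffAt.comp w contDiffAt_fst).smul ?_
  refine (blockEmbedL r n α).contDiff.contDiffAt.comp w ?_
  exact (contDiffAt_partialDeriv _ m hY).comp w (contDiffAt_pi.1 contDiffAt_snd α)

theorem calabiComposition_apply_add_inl (l : Fin (r + s - 1)) (σ : ℝ) (i : AmbientIndex r n) :
    calabiComposition r n c Y (w + σ • compBasis r n (Sum.inl l)) i =
      Real.exp (expCoeff (factorDim r n) (blockIndex i) l * σ) *
        calabiComposition r n c Y w i := by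
  rw [compBasis_inl]
  have h1 (a : Fin (r + s)) : blockScale r n c
      (w + σ • ((EuclideanSpace.single l (1 : ℝ) : EuclideanSpace ℝ (Fin (r + s - 1))),
        (0 : ∀ α, EuclideanSpace ℝ (Fin (n α))))).1 a =
      Real.exp (expCoeff (factorDim r n) a l * σ) * blockScale r n c w.1 a :=
    blockScale_add_smul c w.1 l σ a
  rcases i with a | ⟨α, k⟩
  · exact h1 _
  · have h2 := h1 (Fin.natAdd r α)
    rw [blockScale, blockScale] at h2
    rw [calabiComposition_inr, calabiComposition_inr, h2]
    simp only [blockIndex, Prod.snd_add, Prod.smul_snd, smul_zero, add_zero]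
    ring

theorem partialDeriv_inl_calabiComposition (hY : ∀ α, ContDiffAt ℝ ∞ (Y α) (w.2 α))
    (l : Fin (r + s - 1)) :
    partialDeriv (compBasis r n) (Sum.inl l) (calabiComposition r n c Y) w =
      fun i => expCoeff (factorDim r n) (blockIndex i) l * calabiComposition r n c Y w i :=
  partialDeriv_inl_eq l ((contDiffAt_calabiComposition hY).differentiableAt (by simp))
    fun σ i => calabiComposition_apply_add_inl l σ i

theorem snd_add_smul_compBasis_inr (α : Fin s) (m : Fin (n α)) (σ : ℝ) :
    (w + σ • compBasis r n (Sum.inr ⟨α, m⟩)).2 α = w.2 α + σ • stdBasis (n α) m := by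
  simp [compBasis_inr, stdBasis]

theorem snd_add_smul_compBasis_inr_ne {α β : Fin s} (h : β ≠ α) (m : Fin (n α)) (σ : ℝ) :
    (w + σ • compBasis r n (Sum.inr ⟨α, m⟩)).2 β = w.2 β := by
  simp [compBasis_inr, h]

theorem fst_add_smul_compBasis_inr (α : Fin s) (m : Fin (n α)) (σ : ℝ) :
    (w + σ • compBasis r n (Sum.inr ⟨α, m⟩)).1 = w.1 := by
  simp [compBasis_inr]

theorem partialDeriv_inr_calabiComposition (hY : ∀ α, ContDiffAt ℝ ∞ (Y α) (w.2 α))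
    (α : Fin s) (m : Fin (n α)) :
    partialDeriv (compBasis r n) (Sum.inr ⟨α, m⟩) (calabiComposition r n c Y) w =
      factorDeriv c Y α m w := by
  rw [partialDeriv_inr_eq m ((contDiffAt_calabiComposition hY).differentiableAt (by simp))
    ((hY α).differentiableAt (by simp)) (calabiComposition r n c Y w -
      blockScale r n c w.1 (Fin.natAdd r α) • blockEmbed r n α (Y α (w.2 α)))
    (blockScale r n c w.1 (Fin.natAdd r α) • blockEmbedL r n α)]
  · rfl
  intro σ
  ext (a | ⟨β, k⟩)
  · simp only [Pi.add_apply, Pi.sub_apply, Pi.smul_apply, blockEmbed_inl, smul_apply,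
      calabiComposition_inl, fst_add_smul_compBasis_inr, blockEmbedL_apply]
    simp
  · simp only [Pi.add_apply, Pi.sub_apply, Pi.smul_apply, smul_apply,
      calabiComposition_inr, fst_add_smul_compBasis_inr, blockEmbedL_apply]
    rcases eq_or_ne β α with rfl | h
    · rw [snd_add_smul_compBasis_inr]
      simp [blockScale]
    · rw [snd_add_smul_compBasis_inr_ne h]
      simp [blockEmbed_ne h]

theorem partialDeriv_inl_factorDeriv {α : Fin s} (hY : ContDiffAt ℝ ∞ (Y α) (w.2 α))
    (m : Fin (n α)) (l : Fin (r + s - 1)) :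
    partialDeriv (compBasis r n) (Sum.inl l) (factorDeriv c Y α m) w =
      expCoeff (factorDim r n) (Fin.natAdd r α) l • factorDeriv c Y α m w := by
  rw [partialDeriv_inl_eq l ((contDiffAt_factorDeriv hY m).differentiableAt (by simp))]
  · ext (a | ⟨β, k⟩)
    · simp [factorDeriv]
    · rcases eq_or_ne β α with rfl | h
      · simp [blockIndex]
      · simp [factorDeriv, blockEmbed_ne h]
  · intro σ i
    have h1 : blockScale r n c (w + σ • compBasis r n (Sum.inl l)).1 (Fin.natAdd r α) =
        Real.exp (expCoeff (factorDim r n) (Fin.natAdd r α) l * σ) *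
          blockScale r n c w.1 (Fin.natAdd r α) := by
      rw [compBasis_inl]; exact blockScale_add_smul c w.1 l σ _
    have h2 : (w + σ • compBasis r n (Sum.inl l)).2 = w.2 := by simp [compBasis_inl]
    simp only [factorDeriv, h1, h2, Pi.smul_apply, smul_eq_mul]
    rcases i with a | ⟨β, k⟩
    · simp
    · rcases eq_or_ne β α with rfl | h
      · simp only [blockIndex]; ring
      · simp [blockEmbed_ne h]

theorem partialDeriv_inr_factorDeriv_same {α : Fin s} (hY : ContDiffAt ℝ ∞ (Y α) (w.2 α))
    (m m' : Fin (n α)) :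
    partialDeriv (compBasis r n) (Sum.inr ⟨α, m⟩) (factorDeriv c Y α m') w =
      blockScale r n c w.1 (Fin.natAdd r α) • blockEmbed r n α
        (partialDeriv (stdBasis (n α)) m (partialDeriv (stdBasis (n α)) m' (Y α)) (w.2 α)) := by
  rw [partialDeriv_inr_eq m ((contDiffAt_factorDeriv hY m').differentiableAt (by simp))
    ((contDiffAt_partialDeriv _ m' hY).differentiableAt (by simp)) 0
    (blockScale r n c w.1 (Fin.natAdd r α) • blockEmbedL r n α)]
  · rfl
  · intro σ
    simp only [factorDeriv, fst_add_smul_compBasis_inr, snd_add_smul_compBasis_inr, zero_add]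
    rfl

theorem partialDeriv_inr_factorDeriv_ne {α β : Fin s} (h : β ≠ α)
    (hY : ∀ α, ContDiffAt ℝ ∞ (Y α) (w.2 α)) (m : Fin (n α)) (m' : Fin (n β)) :
    partialDeriv (compBasis r n) (Sum.inr ⟨α, m⟩) (factorDeriv c Y β m') w = 0 := by
  rw [partialDeriv_inr_eq m ((contDiffAt_factorDeriv (hY β) m').differentiableAt (by simp))
    ((hY α).differentiableAt (by simp)) (factorDeriv c Y β m' w) 0]
  · rfl
  · intro σ
    simp only [factorDeriv, fst_add_smul_compBasis_inr, snd_add_smul_compBasis_inr_ne h]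
    simp

end Composition

/-! ### The second fundamental form of the composition -/

/-- Near `u`, the map `Y` is a hypersurface whose position vector is transverse, with second
fundamental form `g` with respect to the transverse field `Λ Y`; the volume of `g` is the volume
induced by this field, so that `g` is the affine metric and `Λ Y` the affine normal of `Y`. -/
structure IsCentredAt {E : Type*} [NormedAddCommGroup E] [NormedSpace ℝ E]
    {κ ι : Type*} [Fintype κ] [DecidableEq κ] [Fintype ι] (b : Module.Basis κ ℝ E)
    (c : Option κ ≃ ι) (Y : E → ι → ℝ) (g : E → Matrix κ κ ℝ) (Λ : ℝ) (u : E) : Prop where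
  contDiffAt : ContDiffAt ℝ ∞ Y u
  frameDet_ne : frameDet b c Y u (Y u) ≠ 0
  hMatrix_eq : hMatrix b c Y u = (Λ * frameDet b c Y u (Y u)) • g u
  abs_det_eq : |(g u).det| = (Λ * frameDet b c Y u (Y u)) ^ 2

section Composition

variable {r s : ℕ} {n : Fin s → ℕ}

@[simp]
theorem factorDim_castAdd (a : Fin r) : factorDim r n (Fin.castAdd s a) = 0 := by
  simp [factorDim]

@[simp]
theorem factorDim_natAdd (α : Fin s) : factorDim r n (Fin.natAdd r α) = n α := by
  simp [factorDim]

theorem sum_factorDim_add_one (hK : 0 < r + s) :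
    ∑ a, ((factorDim r n a : ℝ) + 1) = (compDim r n : ℝ) + 1 := by
  have h : ∑ a, (factorDim r n a + 1) = compDim r n + 1 := by
    rw [Fin.sum_univ_add]
    simp only [factorDim_castAdd, factorDim_natAdd, compDim, Finset.sum_add_distrib]
    simp
    omega
  exact_mod_cast h

theorem card_index :
    Fintype.card (Fin (r + s - 1) ⊕ (Σ α : Fin s, Fin (n α))) = compDim r n := by
  simp [compDim, add_comm]

theorem exists_equiv_option (hK : 0 < r + s) :
    Nonempty (Fin (r + s) ≃ Option (Fin (r + s - 1))) := by
  refine ⟨Fintype.equivOfCardEq ?_⟩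
  simp only [Fintype.card_fin, Fintype.card_option]
  omega

theorem exists_equiv_ambientIndex (hK : 0 < r + s) :
    Nonempty (Option (Fin (r + s - 1) ⊕ (Σ α : Fin s, Fin (n α))) ≃ AmbientIndex r n) := by
  refine ⟨Fintype.equivOfCardEq ?_⟩
  rw [Fintype.card_option, card_index]
  simp [compDim, Finset.sum_add_distrib]
  omega

variable {c : Fin (r + s) → ℝ} {Y : ∀ α, EuclideanSpace ℝ (Fin (n α)) → Fin (n α + 1) → ℝ}
  {w : EuclideanSpace ℝ (Fin (r + s - 1)) × (∀ α, EuclideanSpace ℝ (Fin (n α)))}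
  {cc : Option (Fin (r + s - 1) ⊕ (Σ α : Fin s, Fin (n α))) ≃ AmbientIndex r n}
  {cf : ∀ α, Option (Fin (n α)) ≃ Fin (n α + 1)}
  {g : ∀ α, EuclideanSpace ℝ (Fin (n α)) → Matrix (Fin (n α)) (Fin (n α)) ℝ} {Λ : Fin s → ℝ}

/-- Modulo the tangent space, which contains `∑ lam_a(l) X_a` for all `l`, the block `X_a` of the
position vector `X` is congruent to `W_a / (∑ W_b)` times `X`. -/
theorem frameDet_blockIndex_mul (hK : 0 < r + s) (hY : ∀ α, ContDiffAt ℝ ∞ (Y α) (w.2 α))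
    (v : Fin (r + s) → ℝ) :
    frameDet (compBasis r n) cc (calabiComposition r n c Y) w
        (fun i => v (blockIndex i) * calabiComposition r n c Y w i) =
      (∑ a, ((factorDim r n a : ℝ) + 1) * v a) / ((compDim r n : ℝ) + 1) *
        frameDet (compBasis r n) cc (calabiComposition r n c Y) w
          (calabiComposition r n c Y w) := by
  obtain ⟨e⟩ := exists_equiv_option hK
  set N := factorDim r n
  have hS : ∑ a, ((N a : ℝ) + 1) ≠ 0 := by rw [sum_factorDim_add_one hK]; positivity
  have hv := eq_weighted_mean_add e hS (fun l => (expNorm_pos N l).ne') (sum_mul_expCoeff N)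
    (sum_mul_expCoeff_mul_expCoeff N) v
  rw [sum_factorDim_add_one hK] at hv
  have h1 : (fun i => v (blockIndex i) * calabiComposition r n c Y w i) =
      ((∑ a, ((N a : ℝ) + 1) * v a) / ((compDim r n : ℝ) + 1)) • calabiComposition r n c Y w +
      ∑ l, ((∑ b, ((N b : ℝ) + 1) * expCoeff N b l * v b) / expNorm N l) •
        partialDeriv (compBasis r n) (Sum.inl l) (calabiComposition r n c Y) w := by
    ext i
    simp only [partialDeriv_inl_calabiComposition hY]
    rw [hv (blockIndex i)]
    simp only [Pi.add_apply, Pi.smul_apply, Finset.sum_apply, smul_eq_mul, add_mul,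
      Finset.sum_mul]
    congr 1
    exact Finset.sum_congr rfl fun l _ => by ring
  rw [h1, map_add, map_smul, map_sum]
  simp only [map_smul, frameDet_partialDeriv, smul_eq_mul, mul_zero, Finset.sum_const_zero,
    add_zero]

/-- The block diagonal form with a diagonal first block. -/
noncomputable def compForm (γ : Fin (r + s - 1) → ℝ) (μ : Fin s → ℝ)
    (A : ∀ α, Matrix (Fin (n α)) (Fin (n α)) ℝ) :
    Matrix (Fin (r + s - 1) ⊕ (Σ α : Fin s, Fin (n α)))
      (Fin (r + s - 1) ⊕ (Σ α : Fin s, Fin (n α))) ℝ :=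
  Matrix.fromBlocks (Matrix.diagonal γ) 0 0 (Matrix.blockDiagonal' fun α => μ α • A α)

theorem det_compForm (γ : Fin (r + s - 1) → ℝ) (μ : Fin s → ℝ)
    (A : ∀ α, Matrix (Fin (n α)) (Fin (n α)) ℝ) :
    (compForm γ μ A).det = (∏ l, γ l) * ∏ α, (μ α ^ n α * (A α).det) := by
  simp [compForm, Matrix.det_fromBlocks_zero₂₁, det_blockDiagonal']

/-- The second fundamental form of the composition, with respect to its position vector. -/
theorem hMatrix_calabiComposition (hK : 0 < r + s) {U : ∀ α, Set (EuclideanSpace ℝ (Fin (n α)))}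
    (hU : ∀ α, IsOpen (U α))
    (hY : ∀ α, ∀ u ∈ U α, IsCentredAt (stdBasis (n α)) (cf α) (Y α) (g α) (Λ α) u)
    (hw : ∀ α, w.2 α ∈ U α) :
    hMatrix (compBasis r n) cc (calabiComposition r n c Y) w =
      frameDet (compBasis r n) cc (calabiComposition r n c Y) w (calabiComposition r n c Y w) •
        compForm (fun l => expNorm (factorDim r n) l / ((compDim r n : ℝ) + 1))
          (fun α => ((n α : ℝ) + 1) / ((compDim r n : ℝ) + 1) * Λ α) fun α => g α (w.2 α) := by
  set N := factorDim r n
  have hYw : ∀ α, ContDiffAt ℝ ∞ (Y α) (w.2 α) := fun α => (hY α _ (hw α)).contDiffAt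
  have hev : ∀ᶠ w' in nhds w, ∀ α, ContDiffAt ℝ ∞ (Y α) (w'.2 α) := by
    refine Filter.eventually_all.2 fun α => ?_
    have hc : ContinuousAt (fun w' : EuclideanSpace ℝ (Fin (r + s - 1)) ×
      (∀ α, EuclideanSpace ℝ (Fin (n α))) => w'.2 α) w := by fun_prop
    filter_upwards [hc.eventually ((hU α).mem_nhds (hw α))] with w' hw'
    exact (hY α _ hw').contDiffAt
  have hl (l : Fin (r + s - 1)) : partialDeriv (compBasis r n) (Sum.inl l)
      (calabiComposition r n c Y) =ᶠ[nhds w]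
      fun w i => expCoeff N (blockIndex i) l * calabiComposition r n c Y w i := by
    filter_upwards [hev] with w' hw' using partialDeriv_inl_calabiComposition hw' l
  have hr (α : Fin s) (m : Fin (n α)) : partialDeriv (compBasis r n) (Sum.inr ⟨α, m⟩)
      (calabiComposition r n c Y) =ᶠ[nhds w] factorDeriv c Y α m := by
    filter_upwards [hev] with w' hw' using partialDeriv_inr_calabiComposition hw' α m
  have hzero (α : Fin s) (m : Fin (n α)) : frameDet (compBasis r n) cc
      (calabiComposition r n c Y) w (factorDeriv c Y α m w) = 0 := by
    rw [← partialDeriv_inr_calabiComposition hYw, frameDet_partialDeriv]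
  have hlr (l : Fin (r + s - 1)) (α : Fin s) (m : Fin (n α)) :
      hMatrix (compBasis r n) cc (calabiComposition r n c Y) w (Sum.inl l) (Sum.inr ⟨α, m⟩)
        = 0 := by
    rw [hMatrix_apply, partialDeriv_congr _ _ (hr α m), partialDeriv_inl_factorDeriv (hYw α),
      map_smul, hzero, smul_zero]
  have hsymm := hMatrix_isSymm (compBasis r n) cc (contDiffAt_calabiComposition (c := c) hYw)
  ext (l | ⟨α, m⟩) (l' | ⟨β, m'⟩)
  · rw [hMatrix_apply, partialDeriv_congr _ _ (hl l'), partialDeriv_inl_eq l]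
    · have h1 := frameDet_blockIndex_mul (c := c) (cc := cc) hK hYw
        fun a => expCoeff N a l * expCoeff N a l'
      simp only [mul_assoc] at h1 ⊢
      rw [h1]
      have h2 := sum_mul_expCoeff_mul_expCoeff N l l'
      simp only [mul_assoc] at h2
      change (∑ a, ((N a : ℝ) + 1) * (expCoeff N a l * expCoeff N a l')) / _ * _ = _
      rw [h2]
      simp only [Matrix.smul_apply, compForm, Matrix.fromBlocks_apply₁₁, Matrix.diagonal_apply,
        smul_eq_mul]
      split_ifs <;> ring
    · refine differentiableAt_pi.2 fun i => DifferentiableAt.const_mul ?_ _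
      exact differentiableAt_pi.1 ((contDiffAt_calabiComposition hYw).differentiableAt (by simp)) i
    · intro σ i
      rw [calabiComposition_apply_add_inl]
      ring
  · rw [hlr]
    simp [compForm]
  · rw [← hsymm, Matrix.transpose_apply, hlr]
    simp [compForm]
  · rw [hMatrix_apply, partialDeriv_congr _ _ (hr β m')]
    rcases eq_or_ne β α with rfl | hne
    · rw [partialDeriv_inr_factorDeriv_same (hYw β)]
      -- The functional `ψ` kills the tangent space of the factor, so that it is determined by its
      -- value on the position vector of the factor.
      set φ := frameDet (compBasis r n) cc (calabiComposition r n c Y) w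
      set ψ : (Fin (n β + 1) → ℝ) →ₗ[ℝ] ℝ :=
        φ ∘ₗ (blockScale r n c w.1 (Fin.natAdd r β) • blockEmbed r n β) with hψ
      have h1 (v : Fin (n β + 1) → ℝ) : ψ v =
        φ (blockScale r n c w.1 (Fin.natAdd r β) • blockEmbed r n β v) := rfl
      have h2 := apply_mul_frameDet (stdBasis (n β)) (cf β) (Y β) (w.2 β) ψ
        (fun m => hzero β m)
        (partialDeriv (stdBasis (n β)) m (partialDeriv (stdBasis (n β)) m' (Y β)) (w.2 β))
        (Y β (w.2 β))
      have h3 : ψ (Y β (w.2 β)) = ((n β : ℝ) + 1) / ((compDim r n : ℝ) + 1) *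
          φ (calabiComposition r n c Y w) := by
        have h4 := frameDet_blockIndex_mul (c := c) (cc := cc) hK hYw
          fun a => if a = Fin.natAdd r β then 1 else 0
        simp only [mul_ite, mul_one, mul_zero, Finset.sum_ite_eq', Finset.mem_univ, if_true,
          factorDim_natAdd] at h4
        rw [h1, ← h4]
        congr 1
        ext (a | ⟨α, k⟩)
        · have : Fin.castAdd s a ≠ Fin.natAdd r β := by
            simp [Fin.ext_iff]; omega
          simp [blockIndex, this]
        · rcases eq_or_ne α β with rfl | hne
          · simp [blockIndex, calabiComposition_inr, blockScale]
          · simp [blockIndex, blockEmbed_ne hne, hne]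
      have h5 := (hY β _ (hw β)).frameDet_ne
      rw [← h1]
      refine mul_right_cancel₀ h5 (h2.trans ?_)
      rw [h3, ← hMatrix_apply, (hY β _ (hw β)).hMatrix_eq]
      simp only [Matrix.smul_apply, compForm, Matrix.fromBlocks_apply₂₂,
        Matrix.blockDiagonal'_apply_eq, smul_eq_mul]
      ring
    · rw [partialDeriv_inr_factorDeriv_ne hne hYw, map_zero]
      simp [compForm, Matrix.blockDiagonal'_apply_ne _ _ _ hne.symm]

end Composition

/-! ### The volume of the composition -/

section Composition

variable {r s : ℕ} {n : Fin s → ℕ}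

/-- The distinguished element can be added to the first summand. -/
def optionSumEquiv (T B : Type*) : Option T ⊕ B ≃ Option (T ⊕ B) where
  toFun := Sum.elim (Option.map Sum.inl) (some ∘ Sum.inr)
  invFun o := o.elim (Sum.inl none) (Sum.elim (Sum.inl ∘ some) Sum.inr)
  left_inv := by rintro ((_ | t) | b) <;> rfl
  right_inv := by rintro (_ | (t | b)) <;> rfl

/-- Each of the last `s` blocks consists of the index of the block and the coordinates of its
factor. -/
def sumSigmaOptionEquiv (r : ℕ) {s : ℕ} (n : Fin s → ℕ) :
    Fin r ⊕ (Σ α : Fin s, Option (Fin (n α))) ≃ Fin (r + s) ⊕ (Σ α : Fin s, Fin (n α)) where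
  toFun := Sum.elim (fun a => Sum.inl (Fin.castAdd s a)) fun i =>
    i.2.elim (Sum.inl (Fin.natAdd r i.1)) fun m => Sum.inr ⟨i.1, m⟩
  invFun := Sum.elim (fun a => (finSumFinEquiv.symm a).elim Sum.inl fun α => Sum.inr ⟨α, none⟩)
    fun i => Sum.inr ⟨i.1, some i.2⟩
  left_inv := by rintro (a | ⟨α, _ | m⟩) <;> simp
  right_inv := by
    rintro (a | ⟨α, m⟩)
    · obtain ⟨a, rfl⟩ := finSumFinEquiv.surjective a
      rcases a with a | α <;> simp
    · simp

variable {c : Fin (r + s) → ℝ} {Y : ∀ α, EuclideanSpace ℝ (Fin (n α)) → Fin (n α + 1) → ℝ}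
  {w : EuclideanSpace ℝ (Fin (r + s - 1)) × (∀ α, EuclideanSpace ℝ (Fin (n α)))}
  {cc : Option (Fin (r + s - 1) ⊕ (Σ α : Fin s, Fin (n α))) ≃ AmbientIndex r n}
  {cf : ∀ α, Option (Fin (n α)) ≃ Fin (n α + 1)}
  {g : ∀ α, EuclideanSpace ℝ (Fin (n α)) → Matrix (Fin (n α)) (Fin (n α)) ℝ} {Λ : Fin s → ℝ}

/-- The exponents are chosen so that the product of the block scales, with the dimensions of the
blocks as multiplicities, does not depend on `t`. -/
theorem prod_blockScale_pow (t : EuclideanSpace ℝ (Fin (r + s - 1))) :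
    ∏ a, blockScale r n c t a ^ (factorDim r n a + 1) = ∏ a, c a ^ (factorDim r n a + 1) := by
  have h : ∏ a, expFactor (factorDim r n) t a ^ (factorDim r n a + 1) = 1 := by
    simp only [expFactor_eq, ← Real.exp_nat_mul, ← Real.exp_sum, Finset.mul_sum]
    rw [Finset.sum_comm]
    simp only [Nat.cast_add, Nat.cast_one, ← mul_assoc, ← Finset.sum_mul, sum_mul_expCoeff,
      zero_mul, Finset.sum_const_zero, Real.exp_zero]
  simp only [blockScale, mul_pow, Finset.prod_mul_distrib, h, mul_one]

theorem prod_pow_factorDim (f : Fin (r + s) → ℝ) :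
    ∏ a, f a ^ (factorDim r n a + 1) =
      (∏ a, f (Fin.castAdd s a)) * ∏ α, f (Fin.natAdd r α) ^ (n α + 1) := by
  rw [Fin.prod_univ_add]
  simp

/-- The determinant of the blocks, each of them spanned by the tangent space and the position
vector of its factor. -/
theorem abs_det_blocks (hc : ∀ a, 0 < c a)
    (P : Matrix (AmbientIndex r n) (Fin (r + s) ⊕ (Σ α : Fin s, Fin (n α))) ℝ)
    (hP1 : ∀ i a, P i (Sum.inl a) =
      if blockIndex i = a then calabiComposition r n c Y w i else 0)
    (hP2 : ∀ i α m, P i (Sum.inr ⟨α, m⟩) = factorDeriv c Y α m w i)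
    {m : Type*} [Fintype m] [DecidableEq m] (e₁ : m ≃ AmbientIndex r n)
    (e₂ : m ≃ Fin (r + s) ⊕ (Σ α : Fin s, Fin (n α))) :
    |(P.submatrix e₁ e₂).det| = (∏ a, c a ^ (factorDim r n a + 1)) *
      ∏ α, |frameDet (stdBasis (n α)) (cf α) (Y α) (w.2 α) (Y α (w.2 α))| := by
  rw [abs_det_submatrix_eq P e₁ e₂
    (Equiv.sumCongr (Equiv.refl _) (Equiv.sigmaCongrRight cf)) (sumSigmaOptionEquiv r n)]
  have h : P.submatrix (Equiv.sumCongr (Equiv.refl _) (Equiv.sigmaCongrRight cf))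
      (sumSigmaOptionEquiv r n) =
      Matrix.fromBlocks (Matrix.diagonal fun a => blockScale r n c w.1 (Fin.castAdd s a)) 0 0
        (Matrix.blockDiagonal' fun α => blockScale r n c w.1 (Fin.natAdd r α) •
          Matrix.of fun (k l : Option (Fin (n α))) => (l.elim (Y α (w.2 α)) fun m =>
            partialDeriv (stdBasis (n α)) m (Y α) (w.2 α)) (cf α k)) := by
    have hne (a : Fin r) (α : Fin s) : Fin.castAdd s a ≠ Fin.natAdd r α := by
      simp [Fin.ext_iff]; omega
    ext (a | ⟨α, k⟩) (b | ⟨β, _ | m⟩)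
    · simp [hP1, sumSigmaOptionEquiv, blockIndex, Matrix.diagonal_apply, calabiComposition_inl,
        blockScale]
    · simp [hP1, sumSigmaOptionEquiv, blockIndex, hne]
    · simp [hP2, sumSigmaOptionEquiv, factorDeriv]
    · simp [hP1, sumSigmaOptionEquiv, blockIndex, (hne _ _).symm]
    · rcases eq_or_ne α β with rfl | h
      · simp [hP1, sumSigmaOptionEquiv, blockIndex, calabiComposition_inr, blockScale]
      · simp [hP1, sumSigmaOptionEquiv, blockIndex, h, Matrix.blockDiagonal'_apply_ne _ _ _ h]
    · rcases eq_or_ne α β with rfl | h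
      · simp [hP2, sumSigmaOptionEquiv, factorDeriv]
      · simp [hP2, sumSigmaOptionEquiv, factorDeriv, blockEmbed_ne h,
          Matrix.blockDiagonal'_apply_ne _ _ _ h]
  have hpos (a : Fin (r + s)) : 0 < blockScale r n c w.1 a := mul_pos (hc a) (expFactor_pos _ _ _)
  rw [h, Matrix.det_fromBlocks_zero₂₁, Matrix.det_diagonal, det_blockDiagonal', abs_mul,
    Finset.abs_prod, Finset.abs_prod, ← prod_blockScale_pow (n := n) (c := c) w.1,
    prod_pow_factorDim, mul_assoc, ← Finset.prod_mul_distrib]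
  congr 1
  · exact Finset.prod_congr rfl fun a _ => abs_of_pos (hpos _)
  · refine Finset.prod_congr rfl fun α _ => ?_
    rw [Matrix.det_smul, abs_mul, abs_pow, abs_of_pos (hpos _), Fintype.card_option,
      Fintype.card_fin, frameDet_apply]

/-- The volume of the frame of the composition, formed by its tangent space and its position
vector. -/
theorem frameDet_calabiComposition_sq (hK : 0 < r + s) (hc : ∀ a, 0 < c a)
    (hY : ∀ α, ContDiffAt ℝ ∞ (Y α) (w.2 α)) :
    frameDet (compBasis r n) cc (calabiComposition r n c Y) w (calabiComposition r n c Y w) ^ 2 =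
      (((compDim r n : ℝ) + 1) / ∏ α, ((n α : ℝ) + 1)) ^ 2 *
        (∏ a, c a ^ (factorDim r n a + 1)) ^ 2 *
        ∏ α, frameDet (stdBasis (n α)) (cf α) (Y α) (w.2 α) (Y α (w.2 α)) ^ 2 := by
  obtain ⟨e⟩ := exists_equiv_option hK
  set N := factorDim r n with hN
  set X := calabiComposition r n c Y
  set lam := expCoeff N
  -- The columns of `F` are `X` and its partial derivatives, those of `P` are the blocks of `X` and
  -- the derivatives along the factors; the two are related by the matrix `R`.
  set F : Matrix (AmbientIndex r n) (Option (Fin (r + s - 1) ⊕ (Σ α : Fin s, Fin (n α)))) ℝ :=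
    Matrix.of fun i o => (o.elim (X w) fun m => partialDeriv (compBasis r n) m X w) i with hF
  set P : Matrix (AmbientIndex r n) (Fin (r + s) ⊕ (Σ α : Fin s, Fin (n α))) ℝ :=
    Matrix.of fun i j => Sum.elim (fun a => if blockIndex i = a then X w i else 0)
      (fun j => factorDeriv c Y j.1 j.2 w i) j with hP
  set R : Matrix (Fin (r + s) ⊕ (Σ α : Fin s, Fin (n α)))
    (Option (Fin (r + s - 1)) ⊕ (Σ α : Fin s, Fin (n α))) ℝ :=
    Matrix.fromBlocks (augment lam) 0 0 1 with hR
  set e₁ : (Fin (r + s) ⊕ (Σ α : Fin s, Fin (n α))) ≃ AmbientIndex r n :=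
    (sumSigmaOptionEquiv r n).symm.trans
      (Equiv.sumCongr (Equiv.refl _) (Equiv.sigmaCongrRight cf))
  set e₂ : (Fin (r + s) ⊕ (Σ α : Fin s, Fin (n α))) ≃
      Option (Fin (r + s - 1) ⊕ (Σ α : Fin s, Fin (n α))) :=
    (Equiv.sumCongr e (Equiv.refl _)).trans (optionSumEquiv _ _)
  have h1 : |frameDet (compBasis r n) cc X w (X w)| = |(F.submatrix e₁ e₂).det| := by
    rw [abs_det_submatrix_eq F e₁ e₂ cc (Equiv.refl _), frameDet_apply]
    rfl
  have h2 : F.submatrix e₁ e₂ = P.submatrix e₁ (Equiv.refl _) *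
      Matrix.fromBlocks ((augment lam).submatrix id e) 0 0 1 := by
    have h3 : F.submatrix id (optionSumEquiv _ _) =
        P * R := by
      ext i (o | ⟨α, m⟩)
      · rw [Matrix.mul_apply, Fintype.sum_sum_type]
        rcases o with _ | l
        · simp [hF, hP, hR, optionSumEquiv, augment]
        · simp [hF, hP, hR, optionSumEquiv, augment, X, partialDeriv_inl_calabiComposition hY,
            mul_comm, lam, hN]
      · rw [Matrix.mul_apply, Fintype.sum_sum_type]
        simp [hF, hP, hR, optionSumEquiv, X, partialDeriv_inr_calabiComposition hY, Matrix.one_apply]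
    have h4 : F.submatrix e₁ e₂ = (F.submatrix id (optionSumEquiv _ _)).submatrix e₁
      (Equiv.sumCongr e (Equiv.refl _)) := rfl
    rw [h4, h3]
    ext i (a | j)
    · simp [Matrix.mul_apply, hR]
    · simp [Matrix.mul_apply, hR]
  rw [h2, Matrix.det_mul, abs_mul, abs_det_blocks (cf := cf) hc P (fun i a => rfl)
    (fun i α m => rfl), Matrix.det_fromBlocks_zero₂₁, Matrix.det_one, mul_one] at h1
  have h5 := det_augment_sq e (sum_mul_expCoeff N) (sum_mul_expCoeff_mul_expCoeff N)
  have h6 := prod_expNorm_mul_prod hK N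
  have h7 : ∏ a, ((N a : ℝ) + 1) = ∏ α, ((n α : ℝ) + 1) := by
    rw [Fin.prod_univ_add]; simp [hN]
  have hpos : (0 : ℝ) < ∏ α, ((n α : ℝ) + 1) := Finset.prod_pos fun α _ => by positivity
  rw [sum_factorDim_add_one hK] at h5 h6
  rw [h7] at h5 h6
  have h8 : ((augment lam).submatrix id e).det ^ 2 =
      (((compDim r n : ℝ) + 1) / ∏ α, ((n α : ℝ) + 1)) ^ 2 := by
    rw [div_pow, eq_div_iff (by positivity)]
    calc _ = (((augment lam).submatrix id e).det ^ 2 * ∏ α, ((n α : ℝ) + 1)) *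
        ∏ α, ((n α : ℝ) + 1) := by ring
      _ = _ := by rw [h5, mul_assoc, h6]; ring
  rw [← sq_abs, h1, mul_pow, mul_pow, sq_abs, h8, ← Finset.abs_prod, sq_abs, Finset.prod_pow]
  ring

theorem compConst_pos (hc : ∀ a, 0 < c a) {L : Fin s → ℝ} (hL : ∀ α, L α < 0) :
    0 < compConst r n c L := by
  unfold compConst
  have h1 : 0 < ∏ a : Fin r, c (Fin.castAdd s a) ^ 2 :=
    Finset.prod_pos fun a _ => pow_pos (hc _) _
  have h2 : 0 < ∏ α : Fin s, c (Fin.natAdd r α) ^ (2 * (n α + 1)) /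
      (((n α : ℝ) + 1) ^ (n α + 1) * (-L α) ^ (n α + 2)) :=
    Finset.prod_pos fun α _ => div_pos (pow_pos (hc _) _)
      (mul_pos (by positivity) (pow_pos (neg_pos.2 (hL α)) _))
  positivity

/-- The definition of `C` without a real power, with the product over all blocks of `c_a ^ W_a`. -/
theorem compConst_pow (hc : ∀ a, 0 < c a) {L : Fin s → ℝ} (hL : ∀ α, L α < 0) :
    compConst r n c L ^ (compDim r n + 2) * (((compDim r n : ℝ) + 1) * (∏ α, ((n α : ℝ) + 1)) *
      ∏ α, ((n α : ℝ) + 1) ^ n α * (-L α) ^ (n α + 2)) =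
      (∏ a, c a ^ (factorDim r n a + 1)) ^ 2 := by
  have h1 : 0 < ∏ a : Fin r, c (Fin.castAdd s a) ^ 2 :=
    Finset.prod_pos fun a _ => pow_pos (hc _) _
  have h3 : ∀ α, 0 < ((n α : ℝ) + 1) ^ (n α + 1) * (-L α) ^ (n α + 2) := fun α =>
    mul_pos (by positivity) (pow_pos (neg_pos.2 (hL α)) _)
  have h2 : 0 < ∏ α : Fin s, c (Fin.natAdd r α) ^ (2 * (n α + 1)) /
      (((n α : ℝ) + 1) ^ (n α + 1) * (-L α) ^ (n α + 2)) :=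
    Finset.prod_pos fun α _ => div_pos (pow_pos (hc _) _) (h3 α)
  have h4 : (∏ α, ((n α : ℝ) + 1)) * ∏ α, ((n α : ℝ) + 1) ^ n α * (-L α) ^ (n α + 2) =
      ∏ α, ((n α : ℝ) + 1) ^ (n α + 1) * (-L α) ^ (n α + 2) := by
    rw [← Finset.prod_mul_distrib]
    exact Finset.prod_congr rfl fun α _ => by ring
  have h5 : (∏ α, ((n α : ℝ) + 1) ^ (n α + 1) * (-L α) ^ (n α + 2)) ≠ 0 :=
    (Finset.prod_pos fun α _ => h3 α).ne'
  have h6 : 1 / ((compDim r n : ℝ) + 2) = ((compDim r n + 2 : ℕ) : ℝ)⁻¹ := by push_cast; simp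
  rw [compConst, h6, Real.rpow_inv_natCast_pow (by positivity) (by omega), mul_assoc (_ + _), h4,
    Finset.prod_div_distrib, prod_pow_factorDim, mul_pow, ← Finset.prod_pow, ← Finset.prod_pow]
  simp only [← pow_mul, mul_comm _ 2]
  field_simp

/-- The relation between the volume of the second fundamental form of the composition and its
frame, in which the constant `C` is determined. -/
theorem abs_det_compForm (hK : 0 < r + s) (hc : ∀ a, 0 < c a) {L : Fin s → ℝ}
    (hL : ∀ α, L α < 0)
    (hY : ∀ α, IsCentredAt (stdBasis (n α)) (cf α) (Y α) (g α) (-L α) (w.2 α)) :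
    |(compForm (fun l => expNorm (factorDim r n) l / ((compDim r n : ℝ) + 1))
      (fun α => ((n α : ℝ) + 1) / ((compDim r n : ℝ) + 1) * -L α) fun α => g α (w.2 α)).det| =
      (1 / (((compDim r n : ℝ) + 1) * compConst r n c L)) ^ (compDim r n + 2) *
        frameDet (compBasis r n) cc (calabiComposition r n c Y) w
          (calabiComposition r n c Y w) ^ 2 := by
  have hC := compConst_pos (n := n) hc hL
  have hCp := compConst_pow (n := n) hc hL
  have h6 := prod_expNorm_mul_prod hK (factorDim r n)
  have h7 : ∏ a, ((factorDim r n a : ℝ) + 1) = ∏ α, ((n α : ℝ) + 1) := by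
    rw [Fin.prod_univ_add]; simp
  have hw : (0 : ℝ) < ∏ α, ((n α : ℝ) + 1) := Finset.prod_pos fun α _ => by positivity
  rw [sum_factorDim_add_one hK, h7] at h6
  rw [frameDet_calabiComposition_sq (cf := cf) hK hc fun α => (hY α).contDiffAt, det_compForm]
  set S : ℝ := (compDim r n : ℝ) + 1 with hS
  set C := compConst r n c L
  have hS0 : 0 < S := by positivity
  have h8 : ∀ l, 0 < expNorm (factorDim r n) l / S := fun l => div_pos (expNorm_pos _ l) hS0
  have h9 : ∏ l, expNorm (factorDim r n) l / S =
      (∏ l, expNorm (factorDim r n) l) / S ^ (r + s - 1) := by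
    rw [Finset.prod_div_distrib]; simp
  have h10 : ∀ α, |(((n α : ℝ) + 1) / S * -L α) ^ n α * (g α (w.2 α)).det| =
      (((n α : ℝ) + 1) ^ n α * (-L α) ^ (n α + 2)) / S ^ n α *
        frameDet (stdBasis (n α)) (cf α) (Y α) (w.2 α) (Y α (w.2 α)) ^ 2 := by
    intro α
    have : 0 < -L α := neg_pos.2 (hL α)
    rw [abs_mul, (hY α).abs_det_eq, abs_of_pos (by positivity), mul_pow, mul_pow, div_pow]
    ring
  rw [abs_mul, abs_of_pos (Finset.prod_pos fun l _ => h8 l), Finset.abs_prod,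
    Finset.prod_congr rfl fun α _ => h10 α, Finset.prod_mul_distrib, h9, Finset.prod_div_distrib,
    Finset.prod_pow_eq_pow_sum, ← hCp]
  set Z := ∏ α, ((n α : ℝ) + 1) ^ n α * (-L α) ^ (n α + 2)
  set q := ∏ l, expNorm (factorDim r n) l
  set V := ∏ α, ((n α : ℝ) + 1)
  have h11 : q = S / V := by rw [eq_div_iff hw.ne', h6]
  have h12 : S ^ (compDim r n + 2) = S ^ (r + s - 1) * S ^ (∑ α, n α) * S ^ 2 := by
    rw [← pow_add, ← pow_add]; congr 1; simp [compDim]; omega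
  rw [h11, one_div, mul_inv, mul_pow, inv_pow, inv_pow, h12]
  field_simp

end Composition

/-! ### The Laplacian of the composition -/

theorem laplacian_congr {E W κ : Type*} [NormedAddCommGroup E] [NormedSpace ℝ E]
    [NormedAddCommGroup W] [NormedSpace ℝ W] [Fintype κ] [DecidableEq κ]
    (b : Module.Basis κ ℝ E) {g g' : E → Matrix κ κ ℝ} (F : E → W) {u : E} (h : g =ᶠ[nhds u] g') :
    laplacian b g F u = laplacian b g' F u := by
  rw [laplacian, laplacian, h.eq_of_nhds]
  congr 1
  refine Finset.sum_congr rfl fun i _ => Finset.sum_congr rfl fun j _ => partialDeriv_congr _ _ ?_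
  filter_upwards [h] with w hw
  rw [hw]

/-- The form `g` of a centred hypersurface is as regular as its second fundamental form. -/
theorem differentiableAt_of_isCentredAt {E : Type*} [NormedAddCommGroup E] [NormedSpace ℝ E]
    {κ ι : Type*} [Fintype κ] [DecidableEq κ] [Fintype ι] {b : Module.Basis κ ℝ E}
    {c : Option κ ≃ ι} {Y : E → ι → ℝ} {g : E → Matrix κ κ ℝ} {Λ : ℝ} (hΛ : 0 < Λ) {U : Set E}
    (hU : IsOpen U) (hY : ∀ u ∈ U, IsCentredAt b c Y g Λ u) {u : E} (hu : u ∈ U) (i j : κ) :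
    DifferentiableAt ℝ (fun w => g w i j) u := by
  have h1 := (hY u hu).contDiffAt
  have h2 : DifferentiableAt ℝ
      (fun w => (Λ * frameDet b c Y w (Y w))⁻¹ * hMatrix b c Y w i j) u :=
    (((differentiableAt_frameDet b c h1 (h1.differentiableAt (by simp))).const_mul Λ).inv
      (mul_ne_zero hΛ.ne' (hY u hu).frameDet_ne)).mul (differentiableAt_hMatrix b c h1 i j)
  refine h2.congr_of_eventuallyEq ?_
  filter_upwards [hU.mem_nhds hu] with w hw
  have h3 := (hY w hw).frameDet_ne
  rw [(hY w hw).hMatrix_eq, Matrix.smul_apply, smul_eq_mul,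
    inv_mul_cancel_left₀ (mul_ne_zero hΛ.ne' h3)]

section Composition

variable {r s : ℕ} {n : Fin s → ℕ}

theorem inv_compForm {γ : Fin (r + s - 1) → ℝ} {μ : Fin s → ℝ}
    {A : ∀ α, Matrix (Fin (n α)) (Fin (n α)) ℝ} (hγ : ∀ l, γ l ≠ 0) (hμ : ∀ α, μ α ≠ 0)
    (hA : ∀ α, (A α).det ≠ 0) :
    (compForm γ μ A)⁻¹ = compForm (fun l => (γ l)⁻¹) (fun α => (μ α)⁻¹) fun α => (A α)⁻¹ := by
  refine Matrix.inv_eq_left_inv ?_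
  have h1 (α : Fin s) : (μ α)⁻¹ • (A α)⁻¹ * μ α • A α = 1 := by
    rw [smul_mul_smul_comm, inv_mul_cancel₀ (hμ α), one_smul,
      Matrix.nonsing_inv_mul _ (isUnit_iff_ne_zero.2 (hA α))]
  rw [compForm, compForm, Matrix.fromBlocks_multiply, ← Matrix.blockDiagonal'_mul]
  simp only [h1, Matrix.diagonal_mul_diagonal, inv_mul_cancel₀ (hγ _), Matrix.zero_mul,
    Matrix.mul_zero, add_zero, zero_add, Matrix.diagonal_one]
  have h2 := Matrix.blockDiagonal'_one (m' := fun α => Fin (n α)) (α := ℝ)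
  rw [Pi.one_def] at h2
  rw [h2, Matrix.fromBlocks_one]

theorem sqrt_abs_det_compForm {γ : Fin (r + s - 1) → ℝ} {μ : Fin s → ℝ}
    (A : ∀ α, Matrix (Fin (n α)) (Fin (n α)) ℝ) :
    Real.sqrt |(compForm γ μ A).det| = Real.sqrt |(∏ l, γ l) * ∏ α, μ α ^ n α| *
      ∏ α, Real.sqrt |(A α).det| := by
  rw [det_compForm, Finset.prod_mul_distrib, ← mul_assoc, abs_mul, Real.sqrt_mul (abs_nonneg _),
    Finset.abs_prod, Real.sqrt_prod _ fun _ _ => abs_nonneg _]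

variable {c : Fin (r + s) → ℝ} {Y : ∀ α, EuclideanSpace ℝ (Fin (n α)) → Fin (n α + 1) → ℝ}
  {w : EuclideanSpace ℝ (Fin (r + s - 1)) × (∀ α, EuclideanSpace ℝ (Fin (n α)))}
  {g : ∀ α, EuclideanSpace ℝ (Fin (n α)) → Matrix (Fin (n α)) (Fin (n α)) ℝ}

/-- The metric is the product of a flat metric and multiples of the `g α`, so that the Laplacian
splits into a flat one and the Laplacians of the factors. -/
theorem laplacian_calabiComposition {U : ∀ α, Set (EuclideanSpace ℝ (Fin (n α)))}
    (hU : ∀ α, IsOpen (U α)) (hY : ∀ α, ContDiffOn ℝ ∞ (Y α) (U α))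
    (hg : ∀ α, ∀ u ∈ U α, ∀ i j, DifferentiableAt ℝ (fun w => g α w i j) u)
    (hdet : ∀ α, ∀ u ∈ U α, (g α u).det ≠ 0) (hw : ∀ α, w.2 α ∈ U α)
    {γ : Fin (r + s - 1) → ℝ} {μ : Fin s → ℝ} (hγ : ∀ l, γ l ≠ 0) (hμ : ∀ α, μ α ≠ 0) :
    laplacian (compBasis r n) (fun w => compForm γ μ fun α => g α (w.2 α))
      (calabiComposition r n c Y) w =
      (∑ l, fun i => (γ l)⁻¹ * expCoeff (factorDim r n) (blockIndex i) l ^ 2 *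
        calabiComposition r n c Y w i) +
      ∑ α, ((μ α)⁻¹ * blockScale r n c w.1 (Fin.natAdd r α)) •
        blockEmbed r n α (laplacian (stdBasis (n α)) (g α) (Y α) (w.2 α)) := by
  set X := calabiComposition r n c Y with hX
  set N := factorDim r n
  set k₀ := Real.sqrt |(∏ l, γ l) * ∏ α, μ α ^ n α| with hk₀
  set ρ : ∀ α, EuclideanSpace ℝ (Fin (n α)) → ℝ := fun α u => Real.sqrt |(g α u).det| with hρ
  have hYu (α) (u) (hu : u ∈ U α) : ContDiffAt ℝ ∞ (Y α) u := (hY α).contDiffAt ((hU α).mem_nhds hu)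
  have hYw (α) : ContDiffAt ℝ ∞ (Y α) (w.2 α) := hYu α _ (hw α)
  have hρd (α) : DifferentiableAt ℝ (ρ α) (w.2 α) :=
    ((differentiableAt_det (hg α _ (hw α))).abs (hdet α _ (hw α))).sqrt
      (abs_ne_zero.2 (hdet α _ (hw α)))
  have hgd (α i j) : DifferentiableAt ℝ (fun u => (g α u)⁻¹ i j) (w.2 α) :=
    differentiableAt_inv_apply (hg α _ (hw α)) (hdet α _ (hw α)) i j
  have hproj (α : Fin s) : DifferentiableAt ℝ (fun w' : EuclideanSpace ℝ (Fin (r + s - 1)) ×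
      (∀ α, EuclideanSpace ℝ (Fin (n α))) => w'.2 α) w := by fun_prop
  have hev : ∀ᶠ w' in nhds w, ∀ α, w'.2 α ∈ U α :=
    Filter.eventually_all.2 fun α =>
      (hproj α).continuousAt.eventually ((hU α).mem_nhds (hw α))
  have hprod : DifferentiableAt ℝ (fun w' : EuclideanSpace ℝ (Fin (r + s - 1)) ×
      (∀ α, EuclideanSpace ℝ (Fin (n α))) => k₀ * ∏ α, ρ α (w'.2 α)) w := by
    have h1 (α) : DifferentiableAt ℝ (fun w' : EuclideanSpace ℝ (Fin (r + s - 1)) ×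
        (∀ α, EuclideanSpace ℝ (Fin (n α))) => ρ α (w'.2 α)) w :=
      DifferentiableAt.comp (g := ρ α) w (hρd α) (hproj α)
    fun_prop
  have hinv : ∀ᶠ w' in nhds w, (compForm γ μ fun α => g α (w'.2 α))⁻¹ =
      compForm (fun l => (γ l)⁻¹) (fun α => (μ α)⁻¹) fun α => (g α (w'.2 α))⁻¹ := by
    filter_upwards [hev] with w' hw'
    exact inv_compForm hγ hμ fun α => hdet α _ (hw' α)
  -- The entries of the sum in the definition of the Laplacian.
  set T := fun i j => partialDeriv (compBasis r n) i (fun w' =>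
    (Real.sqrt |(compForm γ μ fun α => g α (w'.2 α)).det| *
      (compForm γ μ fun α => g α (w'.2 α))⁻¹ i j) • partialDeriv (compBasis r n) j X w') w with hT
  have hT0 (i j) (h0 : ∀ A : ∀ α, Matrix (Fin (n α)) (Fin (n α)) ℝ,
      compForm (fun l => (γ l)⁻¹) (fun α => (μ α)⁻¹) A i j = 0) : T i j = 0 := by
    have : (fun w' => (Real.sqrt |(compForm γ μ fun α => g α (w'.2 α)).det| *
      (compForm γ μ fun α => g α (w'.2 α))⁻¹ i j) • partialDeriv (compBasis r n) j X w')
      =ᶠ[nhds w] fun _ => 0 := by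
      filter_upwards [hinv] with w' hw'
      rw [hw', h0, mul_zero, zero_smul]
    rw [hT]
    simp only
    rw [partialDeriv_congr _ _ this]
    simp [partialDeriv]
  have hTl (l : Fin (r + s - 1)) : T (Sum.inl l) (Sum.inl l) = (k₀ * ∏ α, ρ α (w.2 α)) •
      fun i => (γ l)⁻¹ * expCoeff N (blockIndex i) l ^ 2 * X w i := by
    have : (fun w' => (Real.sqrt |(compForm γ μ fun α => g α (w'.2 α)).det| *
      (compForm γ μ fun α => g α (w'.2 α))⁻¹ (Sum.inl l) (Sum.inl l)) •
        partialDeriv (compBasis r n) (Sum.inl l) X w')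
      =ᶠ[nhds w] fun w' i => (k₀ * ∏ α, ρ α (w'.2 α)) * ((γ l)⁻¹ * expCoeff N (blockIndex i) l *
        X w' i) := by
      filter_upwards [hinv, hev] with w' hw' hev'
      rw [hw', hX, partialDeriv_inl_calabiComposition fun α => hYu α _ (hev' α),
        sqrt_abs_det_compForm]
      ext i
      simp [compForm, hk₀, hρ, N]
      ring
    rw [hT]
    simp only
    rw [partialDeriv_congr _ _ this, partialDeriv_inl_eq l]
    · ext i
      simp only [Pi.smul_apply, smul_eq_mul]
      ring
    · refine differentiableAt_pi.2 fun i => hprod.mul (DifferentiableAt.const_mul ?_ _)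
      exact differentiableAt_pi.1
        ((contDiffAt_calabiComposition hYw).differentiableAt (by simp)) i
    · intro σ i
      have h2 : (w + σ • compBasis r n (Sum.inl l)).2 = w.2 := by simp [compBasis_inl]
      rw [hX, calabiComposition_apply_add_inl, h2]
      ring
  have hTr (α : Fin s) (m m' : Fin (n α)) : T (Sum.inr ⟨α, m⟩) (Sum.inr ⟨α, m'⟩) =
      (k₀ * (∏ β ∈ Finset.univ.erase α, ρ β (w.2 β)) * (μ α)⁻¹ *
        blockScale r n c w.1 (Fin.natAdd r α)) • blockEmbed r n α
        (partialDeriv (stdBasis (n α)) m (fun u => (Real.sqrt |(g α u).det| * (g α u)⁻¹ m m') •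
          partialDeriv (stdBasis (n α)) m' (Y α) u) (w.2 α)) := by
    have : (fun w' => (Real.sqrt |(compForm γ μ fun α => g α (w'.2 α)).det| *
      (compForm γ μ fun α => g α (w'.2 α))⁻¹ (Sum.inr ⟨α, m⟩) (Sum.inr ⟨α, m'⟩)) •
        partialDeriv (compBasis r n) (Sum.inr ⟨α, m'⟩) X w')
      =ᶠ[nhds w] fun w' => (k₀ * ∏ α, ρ α (w'.2 α)) • (((μ α)⁻¹ * (g α (w'.2 α))⁻¹ m m') •
        factorDeriv c Y α m' w') := by
      filter_upwards [hinv, hev] with w' hw' hev'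
      rw [hw', hX, partialDeriv_inr_calabiComposition fun α => hYu α _ (hev' α),
        sqrt_abs_det_compForm, mul_smul]
      simp [compForm, hk₀, hρ]
    rw [hT]
    simp only
    rw [partialDeriv_congr _ _ this, partialDeriv_inr_eq m (Ψ := fun u =>
      (Real.sqrt |(g α u).det| * (g α u)⁻¹ m m') • partialDeriv (stdBasis (n α)) m' (Y α) u)
      ?_ ?_ 0 ((k₀ * (∏ β ∈ Finset.univ.erase α, ρ β (w.2 β)) * (μ α)⁻¹ *
        blockScale r n c w.1 (Fin.natAdd r α)) • blockEmbedL r n α)]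
    · rfl
    · intro σ
      have hne : ∏ β ∈ Finset.univ.erase α,
          Real.sqrt |(g β ((w + σ • compBasis r n (Sum.inr ⟨α, m⟩)).2 β)).det| =
          ∏ β ∈ Finset.univ.erase α, Real.sqrt |(g β (w.2 β)).det| :=
        Finset.prod_congr rfl fun β hβ => by
          rw [snd_add_smul_compBasis_inr_ne (Finset.ne_of_mem_erase hβ)]
      simp only [← Finset.mul_prod_erase Finset.univ _ (Finset.mem_univ α), hne, factorDeriv,
        fst_add_smul_compBasis_inr, snd_add_smul_compBasis_inr, zero_add, smul_apply,
        blockEmbedL_apply, map_smul, smul_smul, hρ]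
      congr 1
      ring
    · refine hprod.fun_smul (DifferentiableAt.fun_smul (DifferentiableAt.const_mul ?_ _) ?_)
      · exact (hgd α m m').comp w (hproj α)
      · exact (contDiffAt_factorDeriv (hYw α) m').differentiableAt (by simp)
    · exact ((hρd α).mul (hgd α m m')).smul
        ((contDiffAt_partialDeriv _ m' (hYw α)).differentiableAt (by simp))
  have hρ0 (α) : ρ α (w.2 α) ≠ 0 := (Real.sqrt_pos.2 (abs_pos.2 (hdet α _ (hw α)))).ne'
  have hk0 : k₀ ≠ 0 := by
    refine (Real.sqrt_pos.2 (abs_pos.2 (mul_ne_zero ?_ ?_))).ne'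
    · exact Finset.prod_ne_zero_iff.2 fun l _ => hγ l
    · exact Finset.prod_ne_zero_iff.2 fun α _ => pow_ne_zero _ (hμ α)
  have hρp : ∏ α, ρ α (w.2 α) ≠ 0 := Finset.prod_ne_zero_iff.2 fun α _ => hρ0 α
  have hsum : ∑ i, ∑ j, T i j = (∑ l, T (Sum.inl l) (Sum.inl l)) +
      ∑ α, ∑ m, ∑ m', T (Sum.inr ⟨α, m⟩) (Sum.inr ⟨α, m'⟩) := by
    rw [Fintype.sum_sum_type]
    congr 1
    · refine Finset.sum_congr rfl fun l _ => Fintype.sum_eq_single _ fun j hj => hT0 _ _ fun A => ?_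
      rcases j with l' | j
      · have : l ≠ l' := fun h => hj (by rw [h])
        simp [compForm, this]
      · simp [compForm]
    · rw [Fintype.sum_sigma]
      refine Finset.sum_congr rfl fun α _ => Finset.sum_congr rfl fun m _ => ?_
      rw [Fintype.sum_sum_type, Finset.sum_eq_zero, zero_add, Fintype.sum_sigma,
        Fintype.sum_eq_single α]
      · intro β hβ
        refine Finset.sum_eq_zero fun m' _ => hT0 _ _ fun A => ?_
        simp [compForm, Matrix.blockDiagonal'_apply_ne _ _ _ hβ.symm]
      · exact fun l _ => hT0 _ _ fun A => by simp [compForm]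
  have hlap : laplacian (compBasis r n) (fun w => compForm γ μ fun α => g α (w.2 α)) X w =
      (k₀ * ∏ α, ρ α (w.2 α))⁻¹ • ∑ i, ∑ j, T i j := by
    rw [laplacian, sqrt_abs_det_compForm]
  rw [hlap, hsum, smul_add, Finset.smul_sum, Finset.smul_sum]
  congr 1
  · refine Finset.sum_congr rfl fun l _ => ?_
    rw [hTl, inv_smul_smul₀ (mul_ne_zero hk0 hρp)]
  · refine Finset.sum_congr rfl fun α _ => ?_
    simp only [hTr, ← Finset.smul_sum, ← map_sum]
    rw [laplacian, map_smul, smul_smul, smul_smul,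
      ← Finset.mul_prod_erase Finset.univ (fun α => ρ α (w.2 α)) (Finset.mem_univ α)]
    have h1 : ∏ β ∈ Finset.univ.erase α, ρ β (w.2 β) ≠ 0 :=
      Finset.prod_ne_zero_iff.2 fun β _ => hρ0 β
    have h2 := hρ0 α
    congr 1
    change _ = _ * (ρ α (w.2 α))⁻¹
    field_simp

end Composition

/-! ### The composition as a centred affine hypersphere, in a chart -/

section Composition

variable {r s : ℕ} {n : Fin s → ℕ} {c : Fin (r + s) → ℝ} {L : Fin s → ℝ}
  {Y : ∀ α, EuclideanSpace ℝ (Fin (n α)) → Fin (n α + 1) → ℝ}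
  {w : EuclideanSpace ℝ (Fin (r + s - 1)) × (∀ α, EuclideanSpace ℝ (Fin (n α)))}
  {cc : Option (Fin (r + s - 1) ⊕ (Σ α : Fin s, Fin (n α))) ≃ AmbientIndex r n}
  {cf : ∀ α, Option (Fin (n α)) ≃ Fin (n α + 1)}
  {g : ∀ α, EuclideanSpace ℝ (Fin (n α)) → Matrix (Fin (n α)) (Fin (n α)) ℝ}
  {U : ∀ α, Set (EuclideanSpace ℝ (Fin (n α)))}

/-- The positive constant `Λ = 1 / ((n + 1) C)`, for which `Λ x` is the affine normal of the
composition `x`. -/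
noncomputable def compCurv (r : ℕ) {s : ℕ} (n : Fin s → ℕ) (c : Fin (r + s) → ℝ)
    (L : Fin s → ℝ) : ℝ :=
  1 / (((compDim r n : ℝ) + 1) * compConst r n c L)

theorem compCurv_pos (hc : ∀ a, 0 < c a) (hL : ∀ α, L α < 0) : 0 < compCurv r n c L := by
  have := compConst_pos (n := n) hc hL
  unfold compCurv
  positivity

/-- The coordinate matrix of the affine metric of the composition. -/
noncomputable def compMetric (r : ℕ) {s : ℕ} (n : Fin s → ℕ) (c : Fin (r + s) → ℝ)
    (L : Fin s → ℝ) (A : ∀ α, Matrix (Fin (n α)) (Fin (n α)) ℝ) :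
    Matrix (Fin (r + s - 1) ⊕ (Σ α : Fin s, Fin (n α)))
      (Fin (r + s - 1) ⊕ (Σ α : Fin s, Fin (n α))) ℝ :=
  compForm (fun l => (compCurv r n c L)⁻¹ * (expNorm (factorDim r n) l / ((compDim r n : ℝ) + 1)))
    (fun α => (compCurv r n c L)⁻¹ * (((n α : ℝ) + 1) / ((compDim r n : ℝ) + 1) * -L α)) A

theorem smul_compForm (k : ℝ) (γ : Fin (r + s - 1) → ℝ) (μ : Fin s → ℝ)
    (A : ∀ α, Matrix (Fin (n α)) (Fin (n α)) ℝ) :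
    k • compForm γ μ A = compForm (fun l => k * γ l) (fun α => k * μ α) A := by
  rw [compForm, Matrix.fromBlocks_smul, ← Matrix.blockDiagonal'_smul, compForm]
  congr 1
  · ext i j
    simp [Matrix.diagonal_apply]
  · simp
  · simp
  · congr 1
    ext α
    simp [mul_assoc]

theorem frameDet_calabiComposition_ne (hK : 0 < r + s) (hc : ∀ a, 0 < c a)
    (hY : ∀ α, IsCentredAt (stdBasis (n α)) (cf α) (Y α) (g α) (-L α) (w.2 α)) :
    frameDet (compBasis r n) cc (calabiComposition r n c Y) w (calabiComposition r n c Y w)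
      ≠ 0 := by
  intro h
  have h1 := frameDet_calabiComposition_sq (cf := cf) (cc := cc) hK hc
    fun α => (hY α).contDiffAt
  rw [h, zero_pow two_ne_zero] at h1
  have hn : (∏ α, ((n α : ℝ) + 1)) ≠ 0 := Finset.prod_ne_zero_iff.2 fun α _ => by positivity
  have hS : ((compDim r n : ℝ) + 1) ≠ 0 := by positivity
  refine mul_ne_zero (mul_ne_zero (pow_ne_zero _ (div_ne_zero hS hn)) (pow_ne_zero _ ?_)) ?_ h1.symm
  · exact Finset.prod_ne_zero_iff.2 fun a _ => pow_ne_zero _ (hc a).ne'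
  · exact Finset.prod_ne_zero_iff.2 fun α _ => pow_ne_zero _ (hY α).frameDet_ne

theorem hMatrix_calabiComposition_eq_smul_compMetric (hK : 0 < r + s) (hc : ∀ a, 0 < c a)
    (hL : ∀ α, L α < 0) (hU : ∀ α, IsOpen (U α))
    (hY : ∀ α, ∀ u ∈ U α, IsCentredAt (stdBasis (n α)) (cf α) (Y α) (g α) (-L α) u)
    (hw : ∀ α, w.2 α ∈ U α) :
    hMatrix (compBasis r n) cc (calabiComposition r n c Y) w =
      (compCurv r n c L * frameDet (compBasis r n) cc (calabiComposition r n c Y) w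
        (calabiComposition r n c Y w)) • compMetric r n c L fun α => g α (w.2 α) := by
  have hΛ := (compCurv_pos (n := n) hc hL).ne'
  rw [hMatrix_calabiComposition hK hU hY hw, mul_comm (compCurv r n c L), mul_smul, compMetric,
    smul_compForm (compCurv r n c L)]
  simp only [mul_inv_cancel_left₀ hΛ]

/-- The form `compMetric` is the affine metric of the composition: with `D` the volume of the
frame, `h = Λ D G` and `|det h| = (Λ |D|)^(n+2)`. -/
theorem compMetric_eq_blaschkeMatrix (hK : 0 < r + s) (hc : ∀ a, 0 < c a)
    (hL : ∀ α, L α < 0) (hU : ∀ α, IsOpen (U α))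
    (hY : ∀ α, ∀ u ∈ U α, IsCentredAt (stdBasis (n α)) (cf α) (Y α) (g α) (-L α) u)
    (hw : ∀ α, w.2 α ∈ U α) :
    (hMatrix (compBasis r n) cc (calabiComposition r n c Y) w).det ≠ 0 ∧
      (compMetric r n c L (fun α => g α (w.2 α)) =
          blaschkeMatrix (compBasis r n) cc (calabiComposition r n c Y) w ∨
        compMetric r n c L (fun α => g α (w.2 α)) =
          -blaschkeMatrix (compBasis r n) cc (calabiComposition r n c Y) w) := by
  have hD := frameDet_calabiComposition_ne (cc := cc) hK hc fun α => hY α _ (hw α)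
  have hdet := abs_det_compForm (cc := cc) hK hc hL fun α => hY α _ (hw α)
  have hh := hMatrix_calabiComposition (cc := cc) (c := c) hK hU hY hw
  have hG := hMatrix_calabiComposition_eq_smul_compMetric (cc := cc) hK hc hL hU hY hw
  have hΛ := compCurv_pos (n := n) hc hL
  set D := frameDet (compBasis r n) cc (calabiComposition r n c Y) w
    (calabiComposition r n c Y w)
  change _ = compCurv r n c L ^ _ * _ at hdet
  set Λ := compCurv r n c L
  set h := hMatrix (compBasis r n) cc (calabiComposition r n c Y) w
  have hρ : 0 < Λ * |D| := mul_pos hΛ (abs_pos.2 hD)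
  have habs : |h.det| = (Λ * |D|) ^ (Fintype.card
      (Fin (r + s - 1) ⊕ (Σ α : Fin s, Fin (n α))) + 2) := by
    rw [hh, Matrix.det_smul, abs_mul, hdet, abs_pow, card_index, ← sq_abs D]
    ring
  have hβ := blaschkeMatrix_eq (compBasis r n) cc hρ habs
  refine ⟨fun h0 => ?_, ?_⟩
  · rw [h0, abs_zero] at habs
    exact (pow_pos hρ _).ne habs
  · change _ = (Λ * |D|)⁻¹ • h at hβ
    rw [hβ, hG, smul_smul]
    rcases abs_choice D with h1 | h1
    · left
      rw [h1, inv_mul_cancel₀ (mul_ne_zero hΛ.ne' hD), one_smul]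
    · right
      have : (Λ * -D)⁻¹ * (Λ * D) = -1 := by field_simp
      rw [h1, this, neg_one_smul, neg_neg]

/-- The blocks `X_a` of the position vector are eigenfunctions of the Laplacian with one and the
same eigenvalue: the flat part contributes `Λ (S / W_a - 1)` by Bessel's equality, the part of the
factor contributes `Λ S n_a / W_a`, and the sum is `Λ (S - 1) = n Λ` as `W_a = n_a + 1`. -/
theorem laplacian_compMetric (hK : 0 < r + s) (hc : ∀ a, 0 < c a)
    (hL : ∀ α, L α < 0) (hU : ∀ α, IsOpen (U α))
    (hY : ∀ α, ∀ u ∈ U α, IsCentredAt (stdBasis (n α)) (cf α) (Y α) (g α) (-L α) u)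
    (hlap : ∀ α, ∀ u ∈ U α, laplacian (stdBasis (n α)) (g α) (Y α) u =
      ((n α : ℝ) * -L α) • Y α u)
    (hw : ∀ α, w.2 α ∈ U α) :
    laplacian (compBasis r n) (fun w => compMetric r n c L fun α => g α (w.2 α))
      (calabiComposition r n c Y) w =
      ((compDim r n : ℝ) * compCurv r n c L) • calabiComposition r n c Y w := by
  have hΛ := compCurv_pos (n := n) hc hL
  have hL' : ∀ α, 0 < -L α := fun α => neg_pos.2 (hL α)
  obtain ⟨e⟩ := exists_equiv_option hK
  have hS0 : (0 : ℝ) < (compDim r n : ℝ) + 1 := by positivity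
  have hbessel (a : Fin (r + s)) := sum_lam_mul_lam_div e
    (by rw [sum_factorDim_add_one hK]; exact hS0.ne') (fun l => (expNorm_pos _ l).ne')
    (sum_mul_expCoeff (factorDim r n)) (sum_mul_expCoeff_mul_expCoeff (factorDim r n)) a a
  simp only [sum_factorDim_add_one hK, if_true] at hbessel
  unfold compMetric
  have hdet (α : Fin s) (u) (hu : u ∈ U α) : (g α u).det ≠ 0 := by
    intro h0
    have h1 := (hY α u hu).abs_det_eq
    rw [h0, abs_zero] at h1
    exact pow_ne_zero 2 (mul_ne_zero (hL' α).ne' (hY α u hu).frameDet_ne) h1.symm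
  rw [laplacian_calabiComposition hU
    (fun α u hu => (hY α u hu).contDiffAt.contDiffWithinAt)
    (fun α u hu => differentiableAt_of_isCentredAt (hL' α) (hU α) (hY α) hu)
    hdet hw ?_ ?_]
  · set Λ := compCurv r n c L
    set S := (compDim r n : ℝ) + 1
    have hn : (compDim r n : ℝ) = S - 1 := by simp [S]
    have hflat (a : Fin (r + s)) :
        ∑ l, (Λ⁻¹ * (expNorm (factorDim r n) l / S))⁻¹ * expCoeff (factorDim r n) a l ^ 2 =
          Λ * (S / ((factorDim r n a : ℝ) + 1) - 1) := by
      have h1 : ∑ l, expCoeff (factorDim r n) a l * expCoeff (factorDim r n) a l /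
          expNorm (factorDim r n) l = 1 / ((factorDim r n a : ℝ) + 1) - 1 / S := by
        have h2 : (factorDim r n a : ℝ) + 1 ≠ 0 := by positivity
        have h3 := eq_div_of_mul_eq h2 (hbessel a)
        linarith
      have h4 : Λ * (S / ((factorDim r n a : ℝ) + 1) - 1) =
          Λ * S * (1 / ((factorDim r n a : ℝ) + 1) - 1 / S) := by field_simp
      rw [h4, ← h1, Finset.mul_sum]
      refine Finset.sum_congr rfl fun l _ => ?_
      have := (expNorm_pos (factorDim r n) l).ne'
      field_simp
    simp only [hlap _ _ (hw _)]
    ext i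
    simp only [Pi.add_apply, Finset.sum_apply, Pi.smul_apply, ← Finset.sum_mul, hflat, smul_eq_mul,
      map_smul]
    rcases i with a | ⟨β, k⟩
    · simp [blockIndex, hn, mul_comm]
    · rw [Fintype.sum_eq_single β]
      · simp only [blockIndex, factorDim_natAdd, calabiComposition_inr, blockEmbed_same, hn,
          blockScale]
        have h1 : (n β : ℝ) + 1 ≠ 0 := by positivity
        have h2 := (hL' β).ne'
        have h3 : (Λ⁻¹ * (((n β : ℝ) + 1) / S * -L β))⁻¹ * ((n β : ℝ) * -L β) =
            Λ * (S * n β / ((n β : ℝ) + 1)) := by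
          generalize -L β = x at h2 ⊢
          field_simp
        have h4 : S / ((n β : ℝ) + 1) - 1 + S * n β / ((n β : ℝ) + 1) = S - 1 := by field_simp; ring
        linear_combination (c (Fin.natAdd r β) * expFactor (factorDim r n) w.1 (Fin.natAdd r β) *
          Y β (w.2 β) k) * h3 + Λ * (c (Fin.natAdd r β) *
          expFactor (factorDim r n) w.1 (Fin.natAdd r β) * Y β (w.2 β) k) * h4
      · intro α hα
        rw [blockEmbed_ne hα.symm]
        ring
  · intro l
    have := expNorm_pos (factorDim r n) l
    positivity
  · intro α
    have := hL' α
    positivity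

theorem posDef_compForm {γ : Fin (r + s - 1) → ℝ} {μ : Fin s → ℝ} (hγ : ∀ l, 0 < γ l)
    (hμ : ∀ α, 0 < μ α) {A : ∀ α, Matrix (Fin (n α)) (Fin (n α)) ℝ} (hA : ∀ α, (A α).PosDef) :
    (compForm γ μ A).PosDef := by
  refine Matrix.posDef_iff_dotProduct_mulVec.2 ⟨?_, fun x hx => ?_⟩
  · refine Matrix.IsHermitian.fromBlocks (Matrix.isHermitian_diagonal _) (by simp) ?_
    rw [Matrix.IsHermitian, Matrix.blockDiagonal'_conjTranspose]
    congr 1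
    ext α : 1
    rw [Matrix.conjTranspose_smul, (hA α).isHermitian.eq, star_trivial]
  · have h1 : star x ⬝ᵥ (compForm γ μ A).mulVec x = ∑ l, γ l * x (Sum.inl l) ^ 2 +
        ∑ α, μ α * (star (fun m => x (Sum.inr ⟨α, m⟩)) ⬝ᵥ
          (A α).mulVec fun m => x (Sum.inr ⟨α, m⟩)) := by
      have h2 (α : Fin s) (m : Fin (n α)) :
          ∑ β, ∑ m', (Matrix.blockDiagonal' fun α => μ α • A α) ⟨α, m⟩ ⟨β, m'⟩ *
            x (Sum.inr ⟨β, m'⟩) = ∑ m', μ α * A α m m' * x (Sum.inr ⟨α, m'⟩) := by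
        rw [Fintype.sum_eq_single α]
        · simp
        · intro β hβ
          simp [Matrix.blockDiagonal'_apply_ne _ _ _ hβ.symm]
      simp only [dotProduct, Matrix.mulVec, Fintype.sum_sum_type, Fintype.sum_sigma, compForm,
        Matrix.fromBlocks_apply₁₁, Matrix.fromBlocks_apply₁₂, Matrix.fromBlocks_apply₂₁,
        Matrix.fromBlocks_apply₂₂, Matrix.zero_apply, zero_mul, Finset.sum_const_zero, add_zero,
        zero_add, h2, Pi.star_apply, star_trivial, Matrix.diagonal_apply, ite_mul,
        Finset.sum_ite_eq, Finset.mem_univ, if_true, Finset.mul_sum]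
      congr 1
      · exact Finset.sum_congr rfl fun l _ => by ring
      · exact Finset.sum_congr rfl fun α _ => Finset.sum_congr rfl fun m _ =>
          Finset.sum_congr rfl fun m' _ => by ring
    have h3 (α : Fin s) := (hA α).posSemidef.dotProduct_mulVec_nonneg
      fun m => x (Sum.inr ⟨α, m⟩)
    have h4 : ∀ l ∈ Finset.univ, 0 ≤ γ l * x (Sum.inl l) ^ 2 := fun l _ =>
      mul_nonneg (hγ l).le (sq_nonneg _)
    have h5 : ∀ α ∈ Finset.univ, 0 ≤ μ α * (star (fun m => x (Sum.inr ⟨α, m⟩)) ⬝ᵥ (A α).mulVec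
        fun m => x (Sum.inr ⟨α, m⟩)) := fun α _ => mul_nonneg (hμ α).le (h3 α)
    rw [h1]
    obtain ⟨i, hi⟩ := Function.ne_iff.1 hx
    rcases i with l | ⟨α, m⟩
    · refine add_pos_of_pos_of_nonneg (Finset.sum_pos' h4 ⟨l, Finset.mem_univ _, ?_⟩)
        (Finset.sum_nonneg h5)
      exact mul_pos (hγ l) (by have : x (Sum.inl l) ≠ 0 := hi; positivity)
    · refine add_pos_of_nonneg_of_pos (Finset.sum_nonneg h4)
        (Finset.sum_pos' h5 ⟨α, Finset.mem_univ _, mul_pos (hμ α) ?_⟩)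
      exact (hA α).dotProduct_mulVec_pos fun h => hi (congrFun h m)

theorem posDef_compMetric (hc : ∀ a, 0 < c a) (hL : ∀ α, L α < 0)
    {A : ∀ α, Matrix (Fin (n α)) (Fin (n α)) ℝ} (hA : ∀ α, (A α).PosDef) :
    (compMetric r n c L A).PosDef := by
  have hΛ := compCurv_pos (n := n) hc hL
  refine posDef_compForm (fun l => ?_) (fun α => ?_) hA
  · have := expNorm_pos (factorDim r n) l
    positivity
  · have := neg_pos.2 (hL α)
    positivity

end Composition

/-! ### Hyperbolic affine hyperspheres with centre at the origin -/

section Hypersphere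

variable {E : Type*} [NormedAddCommGroup E] [NormedSpace ℝ E] {κ ι : Type*} [Fintype κ]
  [DecidableEq κ] [Nonempty κ] [Fintype ι] {M : Type*} [TopologicalSpace M] [ChartedSpace E M]
  [IsManifold 𝓘(ℝ, E) ∞ M]

theorem det_hMatrix_eq_zero_of_fderiv_eq_zero (b : Module.Basis κ ℝ E) (c : Option κ ≃ ι)
    {X : E → ι → ℝ} {u : E} (h : fderiv ℝ X u = 0) : (hMatrix b c X u).det = 0 := by
  have h0 : hMatrix b c X u = 0 := by
    ext i j
    rw [hMatrix_apply, frameDet_apply]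
    refine Matrix.det_eq_zero_of_column_eq_zero (some i) fun k => ?_
    simp [partialDeriv, h]
  rw [h0, Matrix.det_zero]

/-- The affine normal of a hyperbolic affine hypersphere with centre at the origin is `-L x`. The
field `ξ + L x` is locally constant; were it a nonzero vector `v`, the position vector would be
parallel to `v`, because the affine normal lines pass through the origin. -/
theorem affineNormal_eq {b : Module.Basis κ ℝ E} {x ξ : M → ι → ℝ}
    {g : OpenPartialHomeomorph M E → E → Matrix κ κ ℝ} {L : ℝ}
    (hx : IsHyperbolicAffineHypersphere 𝓘(ℝ, E) b x g ξ L) (ho : HasAffineCenter x ξ 0)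
    {e : OpenPartialHomeomorph M E} (he : e ∈ atlas E M) {u : E} (hu : u ∈ e.target) :
    ξ (e.symm u) = -L • x (e.symm u) := by
  obtain ⟨⟨hsm, c, hc⟩, -, hL, B, hB, hBL⟩ := hx
  have : IsManifold 𝓘(ℝ, E) 1 M := IsManifold.of_le (n := ∞) (by simp)
  have hdet (w) (hw : w ∈ e.target) : (hMatrix b c (x ∘ e.symm) w).det ≠ 0 := by
    have := (hc e he).2 w (by simpa using hw)
    simpa using this.1
  have hsymm (w) (hw : w ∈ e.target) : MDifferentiableAt 𝓘(ℝ, E) 𝓘(ℝ, E) e.symm w :=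
    mdifferentiableAt_atlas_symm he hw
  have hxd (p : M) : MDifferentiableAt 𝓘(ℝ, E) 𝓘(ℝ, ι → ℝ) x p :=
    (hsm p).mdifferentiableAt (by simp)
  have hcomp (y : M → ι → ℝ) (w) (hw : w ∈ e.target)
      (hy : MDifferentiableAt 𝓘(ℝ, E) 𝓘(ℝ, ι → ℝ) y (e.symm w)) :
      ∃ A : E →L[ℝ] (ι → ℝ), HasFDerivAt (y ∘ e.symm) A w ∧
        ∀ v, A v = mfderiv 𝓘(ℝ, E) 𝓘(ℝ, ι → ℝ) y (e.symm w)
          (mfderiv 𝓘(ℝ, E) 𝓘(ℝ, E) e.symm w v) :=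
    ⟨_, (hy.hasMFDerivAt.comp w (hsymm w hw).hasMFDerivAt).hasFDerivAt, fun _ => rfl⟩
  have hξd (w) (hw : w ∈ e.target) : MDifferentiableAt 𝓘(ℝ, E) 𝓘(ℝ, ι → ℝ) ξ (e.symm w) := by
    -- Otherwise the derivative of `ξ` has the default value `0`, and `dξ = -L dx` forces `dx = 0`.
    by_contra hcon
    refine hdet w hw (det_hMatrix_eq_zero_of_fderiv_eq_zero b c ?_)
    have h0 : ∀ v, (mfderiv 𝓘(ℝ, E) 𝓘(ℝ, ι → ℝ) x (e.symm w) v : ι → ℝ) = 0 := by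
      intro v
      have h1 := hB (e.symm w) v
      rw [mfderiv_zero_of_not_mdifferentiableAt hcon, (hBL _).2 v, map_smul] at h1
      have h2 : L • (mfderiv 𝓘(ℝ, E) 𝓘(ℝ, ι → ℝ) x (e.symm w) v : ι → ℝ) = 0 :=
        neg_eq_zero.1 h1.symm
      exact (smul_eq_zero.1 h2).resolve_left hL.ne
    obtain ⟨A, hA, hAv⟩ := hcomp x w hw (hxd _)
    rw [hA.fderiv]
    ext v : 1
    rw [hAv]
    exact h0 _
  have hF (w) (hw : w ∈ e.target) :
      HasFDerivAt (fun w => ξ (e.symm w) + L • x (e.symm w)) (0 : E →L[ℝ] ι → ℝ) w := by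
    obtain ⟨A, hA, hAv⟩ := hcomp x w hw (hxd _)
    obtain ⟨A', hA', hAv'⟩ := hcomp ξ w hw (hξd w hw)
    refine (hA'.add (hA.const_smul L)).congr_fderiv ?_
    ext v : 1
    have h3 := hB (e.symm w) (mfderiv 𝓘(ℝ, E) 𝓘(ℝ, E) e.symm w v)
    rw [(hBL _).2, map_smul] at h3
    have h4 : A' v = -(L • A v) := by rw [hAv, hAv']; exact h3
    rw [add_apply, smul_apply, h4, neg_add_cancel, zero_apply]
  obtain ⟨ε, hε, hball⟩ := Metric.isOpen_iff.1 e.open_target u hu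
  set v := ξ (e.symm u) + L • x (e.symm u) with hv
  have hconst (w) (hw : w ∈ Metric.ball u ε) : ξ (e.symm w) + L • x (e.symm w) = v := by
    refine Metric.isOpen_ball.is_const_of_fderiv_eq_zero (𝕜 := ℝ)
      (f := fun w => ξ (e.symm w) + L • x (e.symm w))
      (convex_ball u ε).isPreconnected ?_ ?_ hw (Metric.mem_ball_self hε)
    · exact fun w hw => (hF w (hball hw)).differentiableAt.differentiableWithinAt
    · exact fun w hw => (hF w (hball hw)).fderiv
  -- The affine lines `x + ℝ ξ = x + ℝ (v - L x)` pass through the origin; if `v ≠ 0`, then `x` lies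
  -- on the line spanned by `v`.
  have hv0 : v = 0 := by
    by_contra hv0
    refine hdet u hu (det_hMatrix_eq_zero_of_eventually_mem_span b c e.open_target ?_ hu v ?_)
    · have h1 : ContMDiffOn 𝓘(ℝ, E) 𝓘(ℝ, ι → ℝ) ∞ (x ∘ e.symm) e.target :=
        hsm.comp_contMDiffOn
          (contMDiffOn_symm_of_mem_maximalAtlas (IsManifold.subset_maximalAtlas he))
      exact h1.contDiffOn
    · filter_upwards [Metric.ball_mem_nhds u hε] with w hw
      obtain ⟨σ, hσ⟩ := ho (e.symm w)
      have h1 : (1 - σ * L) • x (e.symm w) = -σ • v := by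
        rw [← hconst w hw]
        have h2 : x (e.symm w) = -(σ • ξ (e.symm w)) := eq_neg_of_add_eq_zero_left hσ
        rw [sub_smul, one_smul, smul_add, mul_smul, neg_smul, neg_smul]
        nth_rewrite 1 [h2]
        abel
      have h3 : 1 - σ * L ≠ 0 := by
        intro h0
        rw [h0, zero_smul] at h1
        have hσ0 : σ ≠ 0 := by rintro rfl; simp at h0
        exact hv0 ((smul_eq_zero.1 h1.symm).resolve_left (neg_ne_zero.2 hσ0))
      refine Submodule.mem_span_singleton.2 ⟨(1 - σ * L)⁻¹ * -σ, ?_⟩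
      rw [mul_smul, ← h1, inv_smul_smul₀ h3]
      rfl
  rw [hv0] at hv
  rw [neg_smul]
  exact eq_neg_of_add_eq_zero_left hv.symm

/-- A hyperbolic affine hypersphere with centre at the origin in a chart. -/
theorem exists_isCentredAt {b : Module.Basis κ ℝ E} {x ξ : M → ι → ℝ}
    {g : OpenPartialHomeomorph M E → E → Matrix κ κ ℝ} {L : ℝ}
    (hx : IsHyperbolicAffineHypersphere 𝓘(ℝ, E) b x g ξ L) (ho : HasAffineCenter x ξ 0) :
    ∃ c : Option κ ≃ ι, ∀ e ∈ atlas E M, ContinuousOn (g e) e.target ∧ ∀ u ∈ e.target,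
      IsCentredAt b c (x ∘ e.symm) (g e) (-L) u ∧
      laplacian b (g e) (x ∘ e.symm) u = ((Fintype.card κ : ℝ) * -L) • (x ∘ e.symm) u := by
  obtain ⟨c, hc⟩ := hx.1.2
  refine ⟨c, fun e he => ?_⟩
  have hsm : ContDiffOn ℝ ∞ (x ∘ e.symm) e.target := by
    have h1 : ContMDiffOn 𝓘(ℝ, E) 𝓘(ℝ, ι → ℝ) ∞ (x ∘ e.symm) e.target :=
      hx.1.1.comp_contMDiffOn
        (contMDiffOn_symm_of_mem_maximalAtlas (IsManifold.subset_maximalAtlas he))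
    exact h1.contDiffOn
  have htarget : (e.extend 𝓘(ℝ, E)).target = e.target := by simp
  have hfun : x ∘ (e.extend 𝓘(ℝ, E)).symm = x ∘ e.symm := by ext; simp
  obtain ⟨hg, hgβ⟩ := hc e he
  rw [htarget] at hg hgβ
  rw [hfun] at hgβ
  refine ⟨hg, fun u hu => ?_⟩
  have hlap : (Fintype.card κ : ℝ)⁻¹ • laplacian b (g e) (x ∘ e.symm) u =
      -L • (x ∘ e.symm) u := by
    have h1 := hx.2.1 e he u (by rwa [htarget])
    rw [hfun] at h1
    rw [← h1]
    simpa using affineNormal_eq hx ho he hu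
  obtain ⟨h1, h2, h3⟩ := frameDet_self_of_laplacian_eq b c e.open_target hsm hg hgβ hu hlap
  refine ⟨⟨hsm.contDiffAt (e.open_target.mem_nhds hu), h1, h2, h3⟩, ?_⟩
  have hn : (Fintype.card κ : ℝ) ≠ 0 := by simp
  rw [mul_smul, ← hlap, smul_inv_smul₀ hn]

end Hypersphere

/-! ### The atlas of the product manifold -/

section Atlas

variable {r s : ℕ} {n : Fin s → ℕ} {M : Fin s → Type*} [∀ α, TopologicalSpace (M α)]
  [∀ α, ChartedSpace (EuclideanSpace ℝ (Fin (n α))) (M α)]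

theorem exists_charts_of_mem_atlas {e : OpenPartialHomeomorph (CompDomain r M)
      (ModelProd (EuclideanSpace ℝ (Fin (r + s - 1)))
        (ModelPi fun α => EuclideanSpace ℝ (Fin (n α))))}
    (he : e ∈ atlas (ModelProd (EuclideanSpace ℝ (Fin (r + s - 1)))
        (ModelPi fun α => EuclideanSpace ℝ (Fin (n α)))) (CompDomain r M)) :
    ∃ e' : ∀ α, OpenPartialHomeomorph (M α) (EuclideanSpace ℝ (Fin (n α))),
      (∀ α, e' α ∈ atlas (EuclideanSpace ℝ (Fin (n α))) (M α)) ∧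
      (e.extend (compModel r n)).target = {w | ∀ α, w.2 α ∈ (e' α).target} ∧
      ∀ w, (e.extend (compModel r n)).symm w = (w.1, fun α => (e' α).symm (w.2 α)) := by
  obtain ⟨e₁, he₁, e₂, he₂, rfl⟩ := he
  obtain ⟨e', he', rfl⟩ := he₂
  obtain rfl := mem_singleton_iff.1 he₁
  refine ⟨e', fun α => he' α (mem_univ α), ?_, fun w => ?_⟩
  · ext w
    rw [OpenPartialHomeomorph.extend_target]
    simp [ModelWithCorners.pi]
    exact ⟨fun h α => h.2 α (mem_univ α), fun h => ⟨mem_univ _, fun α _ => h α⟩⟩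
  · rfl

end Atlas

/-! ### The composition on the product manifold -/

section Manifold

variable {r s : ℕ} {n : Fin s → ℕ} {M : Fin s → Type*} [∀ α, TopologicalSpace (M α)]
  {x : ∀ α, M α → Fin (n α + 1) → ℝ} {c : Fin (r + s) → ℝ}

theorem continuous_calabiComposition (hx : ∀ α, Continuous (x α)) :
    Continuous (calabiComposition r n c x) := by
  refine continuous_pi fun i => ?_
  have h1 (a : Fin (r + s)) :
      Continuous fun p : CompDomain r M => c a * expFactor (factorDim r n) p.1 a :=
    continuous_const.mul ((contDiff_expFactor _ a).continuous.comp continuous_fst)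
  rcases i with a | ⟨α, k⟩
  · exact h1 _
  · exact (h1 (Fin.natAdd r α)).mul ((continuous_apply k).comp
      ((hx α).comp ((continuous_apply α).comp continuous_snd)))

variable [∀ α, ChartedSpace (EuclideanSpace ℝ (Fin (n α))) (M α)]

theorem contMDiff_calabiComposition [∀ α, IsManifold 𝓘(ℝ, EuclideanSpace ℝ (Fin (n α))) ∞ (M α)]
    (hx : ∀ α, ContMDiff 𝓘(ℝ, EuclideanSpace ℝ (Fin (n α))) 𝓘(ℝ, Fin (n α + 1) → ℝ) ∞ (x α)) :
    ContMDiff (compModel r n) 𝓘(ℝ, AmbientIndex r n → ℝ) ∞ (calabiComposition r n c x) := by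
  intro p
  refine contMDiffAt_iff.2 ⟨(continuous_calabiComposition fun α =>
    (hx α).continuous).continuousAt, ?_⟩
  obtain ⟨e', he', htarget, hsymm⟩ := exists_charts_of_mem_atlas (r := r) (n := n)
    (chart_mem_atlas (ModelProd (EuclideanSpace ℝ (Fin (r + s - 1)))
      (ModelPi fun α => EuclideanSpace ℝ (Fin (n α)))) p)
  have hmem : ∀ α, (extChartAt (compModel r n) p p).2 α ∈ (e' α).target := by
    have := mem_extChartAt_target (I := compModel r n) p
    rw [extChartAt, htarget] at this
    exact this
  have h1 : ContDiffAt ℝ ∞ (calabiComposition r n c fun α => x α ∘ (e' α).symm)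
      (extChartAt (compModel r n) p p) := by
    refine contDiffAt_calabiComposition fun α => ?_
    have h2 : ContMDiffOn 𝓘(ℝ, EuclideanSpace ℝ (Fin (n α))) 𝓘(ℝ, Fin (n α + 1) → ℝ) ∞
        (x α ∘ (e' α).symm) (e' α).target :=
      (hx α).comp_contMDiffOn
        (contMDiffOn_symm_of_mem_maximalAtlas (IsManifold.subset_maximalAtlas (he' α)))
    exact h2.contDiffOn.contDiffAt ((e' α).open_target.mem_nhds (hmem α))
  have h3 : extChartAt 𝓘(ℝ, AmbientIndex r n → ℝ) (calabiComposition r n c x p) ∘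
      calabiComposition r n c x ∘ (extChartAt (compModel r n) p).symm =
      calabiComposition r n c fun α => x α ∘ (e' α).symm := by
    ext w i
    simp only [extChartAt_model_space_eq_id, PartialEquiv.refl_coe, Function.comp_apply, id_eq]
    rw [extChartAt, hsymm]
    rcases i with a | ⟨α, k⟩ <;> rfl
  rw [h3]
  exact h1.contDiffWithinAt

/-- The composition of hyperbolic affine hyperspheres with centre at the origin. -/
theorem exists_isHyperbolicAffineHypersphere_calabiComposition (hK : 2 ≤ r + s)
    (hn : ∀ α, 0 < n α) [∀ α, IsManifold 𝓘(ℝ, EuclideanSpace ℝ (Fin (n α))) ∞ (M α)]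
    {g : ∀ α, OpenPartialHomeomorph (M α) (EuclideanSpace ℝ (Fin (n α))) →
      EuclideanSpace ℝ (Fin (n α)) → Matrix (Fin (n α)) (Fin (n α)) ℝ}
    {ξ : ∀ α, M α → Fin (n α + 1) → ℝ} {L : Fin s → ℝ}
    (hx : ∀ α, IsHyperbolicAffineHypersphere 𝓘(ℝ, EuclideanSpace ℝ (Fin (n α)))
      (stdBasis (n α)) (x α) (g α) (ξ α) (L α))
    (ho : ∀ α, HasAffineCenter (x α) (ξ α) 0) (hc : ∀ a, 0 < c a) :
    ∃ G η, IsHyperbolicAffineHypersphere (compModel r n) (compBasis r n)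
        (calabiComposition r n c x) G η (-1 / (((compDim r n : ℝ) + 1) * compConst r n c L)) ∧
      ((∀ α, IsPositiveDefinite 𝓘(ℝ, EuclideanSpace ℝ (Fin (n α))) (g α)) →
        IsPositiveDefinite (M := CompDomain r M) (compModel r n) G) := by
  have hK0 : 0 < r + s := by omega
  have hL : ∀ α, L α < 0 := fun α => (hx α).2.2.1
  have hne : ∀ α, Nonempty (Fin (n α)) := fun α => ⟨⟨0, hn α⟩⟩
  have hfac (α) := exists_isCentredAt (hx α) (ho α)
  choose cf hcf using hfac
  obtain ⟨cc⟩ := exists_equiv_ambientIndex (n := n) hK0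
  have hΛ := compCurv_pos (n := n) hc hL
  set Λ := compCurv r n c L with hΛdef
  set X := calabiComposition r n c x with hX
  -- The metric is `h / (Λ D)`, where `D` is the volume of the frame; this makes sense in any chart.
  let G : OpenPartialHomeomorph (CompDomain r M) (ModelProd (EuclideanSpace ℝ (Fin (r + s - 1)))
      (ModelPi fun α => EuclideanSpace ℝ (Fin (n α)))) →
      (EuclideanSpace ℝ (Fin (r + s - 1)) × (∀ α, EuclideanSpace ℝ (Fin (n α)))) →
      Matrix (Fin (r + s - 1) ⊕ (Σ α : Fin s, Fin (n α)))
        (Fin (r + s - 1) ⊕ (Σ α : Fin s, Fin (n α))) ℝ := fun e u =>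
    (Λ * frameDet (compBasis r n) cc (X ∘ (e.extend (compModel r n)).symm) u
      ((X ∘ (e.extend (compModel r n)).symm) u))⁻¹ •
      hMatrix (compBasis r n) cc (X ∘ (e.extend (compModel r n)).symm) u
  have hchart : ∀ e ∈ atlas (ModelProd (EuclideanSpace ℝ (Fin (r + s - 1)))
        (ModelPi fun α => EuclideanSpace ℝ (Fin (n α)))) (CompDomain r M),
      ∃ e' : ∀ α, OpenPartialHomeomorph (M α) (EuclideanSpace ℝ (Fin (n α))),
        (∀ α, e' α ∈ atlas (EuclideanSpace ℝ (Fin (n α))) (M α)) ∧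
        (e.extend (compModel r n)).target = {w | ∀ α, w.2 α ∈ (e' α).target} ∧
        X ∘ (e.extend (compModel r n)).symm =
          calabiComposition r n c (fun α => x α ∘ (e' α).symm) ∧
        ∀ w ∈ (e.extend (compModel r n)).target,
          G e w = compMetric r n c L fun α => g α (e' α) (w.2 α) := by
    intro e he
    obtain ⟨e', he', htarget, hsymm⟩ := exists_charts_of_mem_atlas he
    have hXe : X ∘ (e.extend (compModel r n)).symm =
        calabiComposition r n c (fun α => x α ∘ (e' α).symm) := by
      ext w i
      rw [Function.comp_apply, hsymm]
      rcases i with a | ⟨α, k⟩ <;> rfl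
    refine ⟨e', he', htarget, hXe, fun w hw => ?_⟩
    rw [htarget] at hw
    have hY : ∀ α, ∀ u ∈ (e' α).target, IsCentredAt (stdBasis (n α)) (cf α)
      (x α ∘ (e' α).symm) (g α (e' α)) (-L α) u := fun α u hu => ((hcf α _ (he' α)).2 u hu).1
    have hD := frameDet_calabiComposition_ne (cc := cc) hK0 hc fun α => hY α _ (hw α)
    simp only [G, hXe]
    rw [hMatrix_calabiComposition_eq_smul_compMetric hK0 hc hL (fun α => (e' α).open_target) hY hw,
      inv_smul_smul₀ (mul_ne_zero hΛ.ne' hD)]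
  have hsm : ContMDiff (compModel r n) 𝓘(ℝ, AmbientIndex r n → ℝ) ∞ X :=
    contMDiff_calabiComposition fun α => (hx α).1.1
  have hcurv : -1 / (((compDim r n : ℝ) + 1) * compConst r n c L) = -Λ := by
    rw [hΛdef, compCurv]; ring
  rw [hcurv]
  refine ⟨G, fun p => Λ • X p, ⟨⟨hsm, cc, fun e he => ?_⟩, fun e he u hu => ?_,
    neg_neg_of_pos hΛ, fun p => -Λ • LinearMap.id, fun p v => ?_, fun p => ⟨?_, fun v => rfl⟩⟩,
    fun hpos e he u hu => ?_⟩
  · obtain ⟨e', he', htarget, hXe, hG⟩ := hchart e he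
    refine ⟨ContinuousOn.congr ?_ hG, fun u hu => ?_⟩
    · rw [htarget]
      have hg (α : Fin s) (i j : Fin (n α)) : ContinuousOn (fun w :
          EuclideanSpace ℝ (Fin (r + s - 1)) × (∀ α, EuclideanSpace ℝ (Fin (n α))) =>
          g α (e' α) (w.2 α) i j) {w | ∀ α, w.2 α ∈ (e' α).target} := by
        refine ((continuous_id.matrix_elem i j).comp_continuousOn (hcf α _ (he' α)).1).comp
          (Continuous.continuousOn (by fun_prop)) fun w hw => hw α
      refine continuousOn_pi.2 fun i => continuousOn_pi.2 fun j => ?_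
      rcases i with l | ⟨α, m⟩ <;> rcases j with l' | ⟨β, m'⟩
      · exact continuousOn_const
      · exact continuousOn_const
      · exact continuousOn_const
      · rcases eq_or_ne α β with rfl | h
        · simp only [compMetric, compForm, Matrix.fromBlocks_apply₂₂,
            Matrix.blockDiagonal'_apply_eq, Matrix.smul_apply, smul_eq_mul]
          exact continuousOn_const.mul (hg α m m')
        · simp only [compMetric, compForm, Matrix.fromBlocks_apply₂₂,
            Matrix.blockDiagonal'_apply_ne _ _ _ h]
          exact continuousOn_const
    · rw [hG u hu, hXe]
      rw [htarget] at hu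
      exact compMetric_eq_blaschkeMatrix hK0 hc hL (fun α => (e' α).open_target)
        (fun α u hu => ((hcf α _ (he' α)).2 u hu).1) hu
  · obtain ⟨e', he', htarget, hXe, hG⟩ := hchart e he
    have hopen : IsOpen (e.extend (compModel r n)).target := by
      rw [htarget, ofPred_forall]
      exact isOpen_iInter_of_finite fun α =>
        (e' α).open_target.preimage (by fun_prop)
    have hG' : G e =ᶠ[nhds u] fun w => compMetric r n c L fun α => g α (e' α) (w.2 α) := by
      filter_upwards [hopen.mem_nhds hu] with w hw using hG w hw
    rw [laplacian_congr _ _ hG', hXe]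
    have hu' := hu
    rw [htarget] at hu'
    have hY : ∀ α, ∀ u ∈ (e' α).target, _ := fun α u hu => (hcf α _ (he' α)).2 u hu
    rw [laplacian_compMetric hK0 hc hL (fun α => (e' α).open_target)
      (fun α u hu => (hY α u hu).1) (fun α u hu => by simpa using (hY α u hu).2) hu', ← hXe,
      card_index, smul_smul]
    have hn0 : (compDim r n : ℝ) ≠ 0 := by
      have : compDim r n ≠ 0 := by unfold compDim; omega
      exact_mod_cast this
    rw [inv_mul_cancel_left₀ hn0]
    rfl
  · have hd : MDifferentiableAt (compModel r n) 𝓘(ℝ, AmbientIndex r n → ℝ) X p :=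
      (hsm p).mdifferentiableAt (by simp)
    have h1 : mfderiv (compModel r n) 𝓘(ℝ, AmbientIndex r n → ℝ) (fun p => Λ • X p) p =
        Λ • mfderiv (compModel r n) 𝓘(ℝ, AmbientIndex r n → ℝ) X p := const_smul_mfderiv hd Λ
    rw [h1]
    simp
    rfl
  · rw [affineMeanCurvature, map_smul]
    have h1 : (LinearMap.trace ℝ (TangentSpace (compModel r n) p)) LinearMap.id =
        Module.finrank ℝ (EuclideanSpace ℝ (Fin (r + s - 1)) ×
          (∀ α, EuclideanSpace ℝ (Fin (n α)))) :=
      LinearMap.trace_id ℝ (EuclideanSpace ℝ (Fin (r + s - 1)) ×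
        (∀ α, EuclideanSpace ℝ (Fin (n α))))
    rw [h1, smul_eq_mul, mul_div_assoc, div_self, mul_one]
    have h2 : Module.finrank ℝ (EuclideanSpace ℝ (Fin (r + s - 1)) ×
        (∀ α, EuclideanSpace ℝ (Fin (n α)))) = compDim r n := by
      rw [Module.finrank_eq_card_basis (compBasis r n), card_index]
    have : compDim r n ≠ 0 := by unfold compDim; omega
    rw [h2]
    exact_mod_cast this
  · obtain ⟨e', he', htarget, hXe, hG⟩ := hchart e he
    rw [hG u hu]
    rw [htarget] at hu
    refine posDef_compMetric hc hL fun α => hpos α (e' α) (he' α) _ ?_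
    simpa using hu α

end Manifold

/-! ### Equiaffine equivalence -/

section Equivalence

variable {r s : ℕ} {n : Fin s → ℕ} {M : Fin s → Type*} {x : ∀ α, M α → Fin (n α + 1) → ℝ}

/-- Two compositions of the same factors are images of one another under a diagonal map, whose
determinant is the quotient of the products of the scales counted with the dimensions of the
blocks. -/
theorem equiaffineEquivalent_calabiComposition {c c' : Fin (r + s) → ℝ} (hc : ∀ a, 0 < c a)
    (hc' : ∀ a, 0 < c' a)
    (h : ∏ a, c a ^ (factorDim r n a + 1) = ∏ a, c' a ^ (factorDim r n a + 1)) :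
    EquiaffineEquivalent (calabiComposition r n c x) (calabiComposition r n c' x) := by
  have hd : ∀ i : AmbientIndex r n, c' (blockIndex i) / c (blockIndex i) ≠ 0 := fun i =>
    (div_pos (hc' _) (hc _)).ne'
  let T : (AmbientIndex r n → ℝ) ≃ₗ[ℝ] (AmbientIndex r n → ℝ) :=
    LinearEquiv.piCongrRight fun i => LinearEquiv.smulOfNeZero ℝ ℝ _ (hd i)
  refine ⟨T.toAffineEquiv, ?_, fun p => ?_⟩
  · have h1 : (T : (AmbientIndex r n → ℝ) →ₗ[ℝ] (AmbientIndex r n → ℝ)) =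
        Matrix.toLin' (Matrix.diagonal fun i : AmbientIndex r n =>
          c' (blockIndex i) / c (blockIndex i)) := by
      refine LinearMap.ext fun v => funext fun i => ?_
      simp [T, Matrix.mulVec_diagonal]
    change LinearMap.det (T : (AmbientIndex r n → ℝ) →ₗ[ℝ] (AmbientIndex r n → ℝ)) = 1
    have h2 : ∏ i : AmbientIndex r n, c' (blockIndex i) / c (blockIndex i) =
        ∏ a, (c' a / c a) ^ (factorDim r n a + 1) := by
      rw [prod_pow_factorDim, Fintype.prod_sum_type, Fintype.prod_sigma]
      simp [blockIndex, div_pow]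
    rw [h1, LinearMap.det_toLin', Matrix.det_diagonal, h2]
    simp only [div_pow, Finset.prod_div_distrib, h]
    exact div_self (Finset.prod_ne_zero_iff.2 fun a _ => pow_ne_zero _ (hc' a).ne')
  · ext i
    have h3 := (hc (blockIndex i)).ne'
    change _ = c' (blockIndex i) / c (blockIndex i) * calabiComposition r n c x p i
    rcases i with a | ⟨α, k⟩
    · simp only [calabiComposition_inl, blockIndex] at h3 ⊢
      field_simp
    · simp only [calabiComposition_inr, blockIndex] at h3 ⊢
      field_simp

theorem smul_calabiComposition (d : ℝ) (c : Fin (r + s) → ℝ) (p : CompDomain r M) :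
    d • calabiComposition r n c x p = calabiComposition r n (fun a => d * c a) x p := by
  ext (a | ⟨α, k⟩)
  · simp [calabiComposition_inl, mul_assoc]
  · simp [calabiComposition_inr, mul_assoc]

/-- The scales can be normalized to be all equal, or to be all `1` but the last. -/
theorem exists_equiaffineEquivalent_calabiComposition (hK : 0 < r + s)
    {c : Fin (r + s) → ℝ} (hc : ∀ a, 0 < c a) :
    ∃ d d' : ℝ, 0 < d ∧ 0 < d' ∧
      EquiaffineEquivalent (calabiComposition r n c x)
        (fun p => d • calabiComposition r n (fun _ => 1) x p) ∧
      EquiaffineEquivalent (calabiComposition r n c x)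
        (calabiComposition r n (fun a => if a.val + 1 = r + s then d' else 1) x) ∧
      EquiaffineEquivalent (fun p => d • calabiComposition r n (fun _ => 1) x p)
        (calabiComposition r n (fun a => if a.val + 1 = r + s then d' else 1) x) := by
  have hP : 0 < ∏ a, c a ^ (factorDim r n a + 1) := Finset.prod_pos fun a _ => pow_pos (hc a) _
  obtain ⟨d, hd, hdP⟩ := exists_pos_pow_eq hP (m := ∑ a, (factorDim r n a + 1))
    (Finset.sum_pos (fun _ _ => Nat.succ_pos _) ⟨⟨0, hK⟩, Finset.mem_univ _⟩).ne'
  set z : Fin (r + s) := ⟨r + s - 1, by omega⟩ with hz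
  -- Both `d ^ (n + 1)` and `d' ^ W_K` have to be `∏ c_a ^ W_a`.
  obtain ⟨d', hd', hdP'⟩ := exists_pos_pow_eq hP (m := factorDim r n z + 1) (by omega)
  have h1 : ∏ a : Fin (r + s), d ^ (factorDim r n a + 1) = ∏ a, c a ^ (factorDim r n a + 1) := by
    rw [hdP, Finset.prod_pow_eq_pow_sum]
  have hiff : ∀ a : Fin (r + s), a.val + 1 = r + s ↔ a = z := fun a => by
    rw [hz, Fin.ext_iff]; simp only; omega
  have h2 : ∏ a : Fin (r + s), (if a.val + 1 = r + s then d' else 1) ^ (factorDim r n a + 1) =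
      ∏ a, c a ^ (factorDim r n a + 1) := by
    rw [hdP', Fintype.prod_eq_single z]
    · rw [if_pos ((hiff z).2 rfl)]
    · intro a ha
      rw [if_neg fun h => ha ((hiff a).1 h), one_pow]
  have hfun : (fun p => d • calabiComposition r n (fun _ => 1) x p) =
      calabiComposition r n (fun _ => d) x := by
    ext p : 1
    rw [smul_calabiComposition]
    simp
  have hpos : ∀ a : Fin (r + s), 0 < if a.val + 1 = r + s then d' else 1 := fun a => by
    split_ifs
    · exact hd'
    · exact one_pos
  refine ⟨d, d', hd, hd', ?_, equiaffineEquivalent_calabiComposition hc hpos h2.symm, ?_⟩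
  · rw [hfun]
    exact equiaffineEquivalent_calabiComposition hc (fun _ => hd) h1.symm
  · rw [hfun]
    exact equiaffineEquivalent_calabiComposition (fun _ => hd) hpos (h1.trans h2.symm)

end Equivalence

end EquiAffine

theorem mainTheorem3 (r s : ℕ) (hK : 2 ≤ r + s) (n : Fin s → ℕ) (hn : ∀ α, 0 < n α)
    (M : Fin s → Type*) [∀ α, TopologicalSpace (M α)]
    [∀ α, ChartedSpace (EuclideanSpace ℝ (Fin (n α))) (M α)]
    [∀ α, IsManifold 𝓘(ℝ, EuclideanSpace ℝ (Fin (n α))) ∞ (M α)]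
    (x : ∀ α, M α → Fin (n α + 1) → ℝ)
    (g : ∀ α, OpenPartialHomeomorph (M α) (EuclideanSpace ℝ (Fin (n α))) →
      EuclideanSpace ℝ (Fin (n α)) → Matrix (Fin (n α)) (Fin (n α)) ℝ)
    (ξ : ∀ α, M α → Fin (n α + 1) → ℝ) (L : Fin s → ℝ)
    (hx : ∀ α, EquiAffine.IsHyperbolicAffineHypersphere 𝓘(ℝ, EuclideanSpace ℝ (Fin (n α)))
      (EquiAffine.stdBasis (n α)) (x α) (g α) (ξ α) (L α))
    (ho : ∀ α, EquiAffine.HasAffineCenter (x α) (ξ α) 0)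
    (c : Fin (r + s) → ℝ) (hc : ∀ a, 0 < c a) :
    (∃ G η,
      EquiAffine.IsHyperbolicAffineHypersphere (EquiAffine.compModel r n)
        (EquiAffine.compBasis r n) (EquiAffine.calabiComposition r n c x) G η
        (-1 / (((EquiAffine.compDim r n : ℝ) + 1) * EquiAffine.compConst r n c L)) ∧
      ((∀ α, EquiAffine.IsPositiveDefinite 𝓘(ℝ, EuclideanSpace ℝ (Fin (n α))) (g α)) →
        EquiAffine.IsPositiveDefinite (M := EquiAffine.CompDomain r M)
          (EquiAffine.compModel r n) G)) ∧
    ∃ d d' : ℝ, 0 < d ∧ 0 < d' ∧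
      EquiAffine.EquiaffineEquivalent (EquiAffine.calabiComposition r n c x)
        (fun p => d • EquiAffine.calabiComposition r n (fun _ => 1) x p) ∧
      EquiAffine.EquiaffineEquivalent (EquiAffine.calabiComposition r n c x)
        (EquiAffine.calabiComposition r n
          (fun a => if a.val + 1 = r + s then d' else 1) x) ∧
      EquiAffine.EquiaffineEquivalent
        (fun p => d • EquiAffine.calabiComposition r n (fun _ => 1) x p)
        (EquiAffine.calabiComposition r n
          (fun a => if a.val + 1 = r + s then d' else 1) x) := by
  exact ⟨EquiAffine.exists_isHyperbolicAffineHypersphere_calabiComposition hK hn hx ho hc,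
    EquiAffine.exists_equiaffineEquivalent_calabiComposition (by omega) hc⟩
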